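/- Let $M,a,e,\Lambda\in\mathbb R$, $\Xi=1+\frac{a^2\Lambda}{3}\neq0$, $\Delta_\theta=1+\frac{a^2\Lambda}{3}\cos^2\theta$, $\Delta_r=(1-\frac{\Lambda}{3}r^2)(r^2+a^2)-2Mr+e^2$, $\rho^2=r^2+a^2\cos^2\theta$, $\bar\rho=r+ia\cos\theta$, $\bar\rho^*=r-ia\cos\theta$. The Kerr–Newman–(anti) de Sitter metric (signature $+---$) and electromagnetic potential are $$ds^2=\frac{\Delta_r}{\Xi^2\rho^2}(dt-a\sin^2\theta\,d\phi)^2-\frac{\rho^2}{\Delta_r}dr^2-\frac{\rho^2}{\Delta_\theta}d\theta^2-\frac{\Delta_\theta\sin^2\theta}{\Xi^2\rho^2}(a\,dt-(r^2+a^2)d\phi)^2,\qquad A=-\frac{er}{\Xi\rho^2}(dt-a\sin^2\theta\,d\phi).$$ Consider, in coordinates $(t,r,\theta,\phi)$, the vectors $$l=\Big(\tfrac{(r^2+a^2)\Xi}{\Delta_r},1,0,\tfrac{a\Xi}{\Delta_r}\Big),\quad n=\tfrac{1}{2\rho^2}\big(\Xi(r^2+a^2),-\Delta_r,0,a\Xi\big),\quad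 m=\tfrac{1}{\bar\rho\sqrt{2\Delta_\theta}}\Big(ia\Xi\sin\theta,0,\Delta_\theta,\tfrac{i\Xi}{\sin\theta}\Big),\quad \overline m .$$ The Dirac equation for a particle of charge $q$ and mass $\mu_*$ is the system, for two-spinors $P,Q$, $$(\nabla_{A\dot B}+iqA_{A\dot B})P^A+i\mu_*\overline Q_{\dot B}=0,\qquad(\nabla_{A\dot B}-iqA_{A\dot B})Q^A+i\mu_*\overline P_{\dot B}=0,$$ taken in the spin dyad of this tetrad. Let $\mu_*=\mu/\sqrt2$, with $q,\mu,m\in\mathbb R$ and $\omega\in\mathbb C$. **(A)** At every point with $0<\theta<\pi$, $\Delta_\theta>0$, $\Delta_r\ne0$, $\rho^2\neq0$: 1. $(l,n,m,\overline m)$ is a null tetrad with $l\cdot n=1$, $m\cdot\overline m=-1$, all other products being zero. 2. Its Newman–Penrose spin coefficients are $\kappa=\sigma=\lambda_{NP}=\nu=\varepsilon=0$ and $$\pi=\frac{ia\sin\theta\sqrt{2\Delta_\theta}}{2(\bar\rho^*)^2},\quad \beta=\frac{1}{2\sqrt2\,\bar\rho\sin\theta}\frac{d}{d\theta}(\sqrt{\Delta_\theta}\sin\theta),\quad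 \gamma=\frac{1}{4\rho^2}\frac{d\Delta_r}{dr}-\frac{\Delta_r}{2\rho^2\bar\rho^*},\quad \varrho=-\frac1{\bar\rho^*},$$ $$\mu_{NP}=-\frac{\Delta_r}{2\rho^2\bar\rho^*},\quad \tau=-\frac{i\sqrt{2\Delta_\theta}\,a\sin\theta}{2\rho^2},\quad \alpha=\pi-\beta^* .$$ 3. The components $\dot B=\dot 1,\dot 0$ of the first spinor equation are, with $D=l^\mu\partial_\mu$, $D'=n^\mu\partial_\mu$, $\delta=m^\mu\partial_\mu$, $\delta'=\overline m^\mu\partial_\mu$, $$(D'-\gamma+\mu_{NP}+iqn^\mu A_\mu)P^{(1)}+(\delta-\tau+\beta+iqm^\mu A_\mu)P^{(0)}=-i\mu_*\overline Q^{(\dot0)},$$ $$(-D+\varrho-\varepsilon-iql^\mu A_\mu)P^{(0)}+(-\delta'+\alpha-\pi-iq\overline m^\mu A_\mu)P^{(1)}=-i\mu_*\overline Q^{(\dot1)},$$ and those of the second one are the same with $(P,Q,q)$ replaced by $(Q,P,-q)$. 4. On fields $e^{i(m\phi-\omega t)}f(r,\theta)$, with $K=ma-\omega(r^2+a^2)$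 and $H=\omega a\sin\theta-\frac m{\sin\theta}$, these derivatives act on $f$ as $$D=\partial_r+\frac{i\Xi K}{\Delta_r},\quad D'=-\frac{\Delta_r}{2\rho^2}\Big(\partial_r-\frac{i\Xi K}{\Delta_r}\Big),\quad \delta=\frac{\sqrt{\Delta_\theta}}{\sqrt2\bar\rho}\Big(\partial_\theta+\frac{\Xi H}{\Delta_\theta}\Big),\quad \delta'=\frac{\sqrt{\Delta_\theta}}{\sqrt2\bar\rho^*}\Big(\partial_\theta-\frac{\Xi H}{\Delta_\theta}\Big).$$ **(B)** Let $I\subseteq\mathbb R$, $J\subseteq(0,\pi)$ be open with $\Delta_r>0$ on $I$, $\Delta_\theta>0$ on $J$ and $\rho^2\ne0$ on $I\times J$, and let $R^{(\pm)}$ and $S^{(\pm)}$ be complex-valued functions, differentiable on $I$ and on $J$ respectively. Put $$P^{(0)}=\frac{e^{i(m\phi-\omega t)}S^{(-)}R^{(-)}}{\sqrt2\,\bar\rho^*},\quad P^{(1)}=\frac{e^{i(m\phi-\omega t)}S^{(+)}R^{(+)}}{\sqrt{\Delta_r}},\quad \overline Q^{(\dot0)}=-\frac{e^{i(m\phi-\omega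 t)}S^{(+)}R^{(-)}}{\sqrt2\,\bar\rho},\quad \overline Q^{(\dot1)}=\frac{e^{i(m\phi-\omega t)}S^{(-)}R^{(+)}}{\sqrt{\Delta_r}} .$$ If, for some $\lambda\in\mathbb C$, $$\sqrt{\Delta_r}\Big\{\frac{dR^{(-)}}{dr}+\frac{i\Xi K}{\Delta_r}R^{(-)}-\frac{iqer}{\Delta_r}R^{(-)}\Big\}=(\lambda+i\mu r)R^{(+)},$$ $$\sqrt{\Delta_r}\frac{dR^{(+)}}{dr}-\frac{i\Xi K}{\sqrt{\Delta_r}}R^{(+)}+\frac{ieqr}{\sqrt{\Delta_r}}R^{(+)}=(\lambda-i\mu r)R^{(-)}$$ on $I$ and $$\sqrt{\Delta_\theta}\frac{dS^{(+)}}{d\theta}-\frac{\Xi H}{\sqrt{\Delta_\theta}}S^{(+)}+\frac{1}{2\sin\theta}\frac{d(\sqrt{\Delta_\theta}\sin\theta)}{d\theta}S^{(+)}=(-\lambda+\mu a\cos\theta)S^{(-)},$$ $$\sqrt{\Delta_\theta}\frac{dS^{(-)}}{d\theta}+\frac{\Xi H}{\sqrt{\Delta_\theta}}S^{(-)}+\frac{1}{2\sin\theta}\frac{d(\sqrt{\Delta_\theta}\sin\theta)}{d\theta}S^{(-)}=(\lambda+\mu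 a\cos\theta)S^{(+)}$$ on $J$, then $(P,Q)$ solves the Dirac equation for $r\in I$, $\theta\in J$. Conversely, if $(P,Q)$ solves the Dirac equation there, and neither $(R^{(-)},R^{(+)})$ vanishes identically on $I$ nor $(S^{(-)},S^{(+)})$ on $J$, then there is a constant $\lambda\in\mathbb C$ such that these four equations hold. **(C)** In the situation of (B) with $\Lambda=0$, put $\Delta=r^2+a^2+e^2-2Mr$. The four equations are then equivalent to Page's Kerr–Newman equations: the two radial equations with $\Xi=1$ and $\Delta_r=\Delta$, and $$\frac{dS^{(+)}}{d\theta}+\Big[\frac m{\sin\theta}-\omega a\sin\theta+\frac{\cot\theta}2\Big]S^{(+)}=(-\lambda+\mu a\cos\theta)S^{(-)},$$ $$\frac{dS^{(-)}}{d\theta}+\Big[\omega a\sin\theta-\frac m{\sin\theta}+\frac{\cot\theta}2\Big]S^{(-)}=(\lambda+\mu a\cos\theta)S^{(+)}.$$ If the radial ones hold on $I$ then, with $\mathcal K=(r^2+a^2)\omega-ma+eqr$, at every $r\in I$ with $\lambda+i\mu r\neq0$ the function $R^{(-)}$ is twice differentiable and $$\Big[\Delta\frac{d^2}{dr^2}+\Big(r-M-\frac{i\mu\Delta}{\lambda+i\mu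 r}\Big)\frac d{dr}+\frac{\mathcal K^2+i(r-M)\mathcal K}{\Delta}-2i\omega r-ieq-\frac{\mu\mathcal K}{\lambda+i\mu r}-\mu^2r^2-\lambda^2\Big]R^{(-)}=0.$$ If the angular ones hold on $J$ then, at every $\theta\in J$ with $\lambda+\mu a\cos\theta\ne0$, $S^{(-)}$ is twice differentiable and $$\frac{\mu a^2\omega\sin^2\theta-\mu am+\frac{\mu a}2\cos\theta}{\lambda+\mu a\cos\theta}S^{(-)}+\frac{\mu a\sin\theta}{\lambda+\mu a\cos\theta}\frac{dS^{(-)}}{d\theta}+\frac{d^2S^{(-)}}{d\theta^2}+\cot\theta\frac{dS^{(-)}}{d\theta}$$ $$+\Big[\omega a\cos\theta+\frac{m\cos\theta}{\sin^2\theta}-\frac1{2\sin^2\theta}-\Big(\omega a\sin\theta-\frac m{\sin\theta}\Big)^2+\frac{\cot^2\theta}4\Big]S^{(-)}=(-\lambda^2+\mu^2a^2\cos^2\theta)S^{(-)}.$$ -/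

import Mathlib

open scoped ComplexConjugate

noncomputable section

namespace KNdS

/-- Parameters of a Kerr–Newman–(anti-)de Sitter spacetime: mass `M`, rotation parameter `a`,
electric charge `e`, cosmological constant `Λ` (of either sign). -/
structure Params where
  M : ℝ
  a : ℝ
  e : ℝ
  Λ : ℝ

/-- Boyer–Lindquist coordinates `x 0 = t`, `x 1 = r`, `x 2 = θ`, `x 3 = φ`. -/
abbrev Point := Fin 4 → ℝ

/-! ### The spacetime -/

def Xi (p : Params) : ℝ := 1 + p.a ^ 2 * p.Λ / 3

def Dθ (p : Params) (θ : ℝ) : ℝ := 1 + p.a ^ 2 * p.Λ / 3 * Real.cos θ ^ 2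

def Dr (p : Params) (r : ℝ) : ℝ :=
  (1 - p.Λ / 3 * r ^ 2) * (r ^ 2 + p.a ^ 2) - 2 * p.M * r + p.e ^ 2

def rhoSq (p : Params) (r θ : ℝ) : ℝ := r ^ 2 + p.a ^ 2 * Real.cos θ ^ 2

/-- `rhoBar = r + i a cos θ`; its complex conjugate is `r - i a cos θ`. -/
def rhoBar (p : Params) (r θ : ℝ) : ℂ := r + Complex.I * p.a * Real.cos θ

/-- The one-form `dt - a sin² θ dφ`. -/
def formT (p : Params) (x : Point) : Fin 4 → ℝ := ![1, 0, 0, -(p.a * Real.sin (x 2) ^ 2)]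

/-- The one-form `a dt - (r² + a²) dφ`. -/
def formPhi (p : Params) (x : Point) : Fin 4 → ℝ := ![p.a, 0, 0, -(x 1 ^ 2 + p.a ^ 2)]

def formR : Fin 4 → ℝ := ![0, 1, 0, 0]

def formTheta : Fin 4 → ℝ := ![0, 0, 1, 0]

/-- The metric tensor, of signature `(+,-,-,-)`. -/
def metric (p : Params) (x : Point) (i j : Fin 4) : ℝ :=
  Dr p (x 1) / (Xi p ^ 2 * rhoSq p (x 1) (x 2)) * (formT p x i * formT p x j)
    - rhoSq p (x 1) (x 2) / Dr p (x 1) * (formR i * formR j)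
    - rhoSq p (x 1) (x 2) / Dθ p (x 2) * (formTheta i * formTheta j)
    - Dθ p (x 2) * Real.sin (x 2) ^ 2 / (Xi p ^ 2 * rhoSq p (x 1) (x 2))
        * (formPhi p x i * formPhi p x j)

/-- The electromagnetic potential one-form. -/
def potential (p : Params) (x : Point) (i : Fin 4) : ℝ :=
  -(p.e * x 1) / (Xi p * (x 1 ^ 2 + p.a ^ 2 * Real.cos (x 2) ^ 2)) * formT p x i

/-! ### The null tetrad and its rotation coefficients -/

/-- The generalised Kinnersley tetrad `(l, n, m, m̄)`, numbered `0, 1, 2, 3`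
(contravariant components). -/
def tetrad (p : Params) (x : Point) : Fin 4 → Fin 4 → ℂ :=
  ![![(((x 1 ^ 2 + p.a ^ 2) * Xi p / Dr p (x 1) : ℝ) : ℂ), 1, 0,
      ((p.a * Xi p / Dr p (x 1) : ℝ) : ℂ)],
    ![((Xi p * (x 1 ^ 2 + p.a ^ 2) / (2 * rhoSq p (x 1) (x 2)) : ℝ) : ℂ),
      ((-Dr p (x 1) / (2 * rhoSq p (x 1) (x 2)) : ℝ) : ℂ), 0,
      ((p.a * Xi p / (2 * rhoSq p (x 1) (x 2)) : ℝ) : ℂ)],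
    fun j => 1 / (rhoBar p (x 1) (x 2) * (√(2 * Dθ p (x 2)) : ℝ)) *
      (![Complex.I * p.a * Xi p * Real.sin (x 2), 0, (Dθ p (x 2) : ℂ),
        Complex.I * Xi p / Real.sin (x 2)] : Fin 4 → ℂ) j,
    fun j => -1 / (conj (rhoBar p (x 1) (x 2)) * (√(2 * Dθ p (x 2)) : ℝ)) *
      (![Complex.I * p.a * Xi p * Real.sin (x 2), 0, -(Dθ p (x 2) : ℂ),
        Complex.I * Xi p / Real.sin (x 2)] : Fin 4 → ℂ) j]

/-- The frame metric of a null tetrad `(l, n, m, m̄)`: `l·n = 1`, `m·m̄ = -1`, all other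
products zero. -/
def nullEta : Matrix (Fin 4) (Fin 4) ℂ := !![0, 1, 0, 0; 1, 0, 0, 0; 0, 0, 0, -1; 0, 0, -1, 0]

/-- The dual co-tetrad: covariant components `e_{(b) i} = g_{ij} e_{(b)}^j`. -/
def coTetrad (p : Params) (b : Fin 4) (x : Point) (i : Fin 4) : ℂ :=
  ∑ j, (metric p x i j : ℂ) * tetrad p x b j

/-- The coordinate partial derivative `∂_j f` at `x`. -/
def pd (j : Fin 4) (f : Point → ℂ) (x : Point) : ℂ :=
  deriv (fun s : ℝ => f (Function.update x j s)) (x j)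

/-- The derivative of `f` along the tetrad vector number `c`. -/
def frameDeriv (p : Params) (c : Fin 4) (f : Point → ℂ) (x : Point) : ℂ :=
  ∑ j, tetrad p x c j * pd j f x

/-- Chandrasekhar's symbols
`λ_{(a)(b)(c)} = e_{(b) i,j} (e_{(a)}^i e_{(c)}^j - e_{(a)}^j e_{(c)}^i)`. -/
def lambdaSymbol (p : Params) (x : Point) (a b c : Fin 4) : ℂ :=
  ∑ i, ∑ j, pd j (fun y => coTetrad p b y i) x *
    (tetrad p x a i * tetrad p x c j - tetrad p x a j * tetrad p x c i)

/-- The Ricci rotation coefficients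
`γ_{(a)(b)(c)} = ½ (λ_{(a)(b)(c)} + λ_{(c)(a)(b)} - λ_{(b)(c)(a)})`. -/
def ricciRot (p : Params) (x : Point) (a b c : Fin 4) : ℂ :=
  (lambdaSymbol p x a b c + lambdaSymbol p x c a b - lambdaSymbol p x b c a) / 2

/-! The twelve Newman–Penrose spin coefficients. With the tetrad numbered from `1`, they are
`κ = γ₃₁₁`, `σ = γ₃₁₃`, `ρ = γ₃₁₄`, `τ = γ₃₁₂`, `ν = γ₂₄₂`, `μ = γ₂₄₃`, `λ = γ₂₄₄`, `π = γ₂₄₁`,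
`ε = ½(γ₂₁₁ + γ₃₄₁)`, `γ = ½(γ₂₁₂ + γ₃₄₂)`, `β = ½(γ₂₁₃ + γ₃₄₃)`, `α = ½(γ₂₁₄ + γ₃₄₄)`. -/

def npκ (p : Params) (x : Point) : ℂ := ricciRot p x 2 0 0
def npσ (p : Params) (x : Point) : ℂ := ricciRot p x 2 0 2
def npρ (p : Params) (x : Point) : ℂ := ricciRot p x 2 0 3
def npτ (p : Params) (x : Point) : ℂ := ricciRot p x 2 0 1
def npν (p : Params) (x : Point) : ℂ := ricciRot p x 1 3 1
def npμ (p : Params) (x : Point) : ℂ := ricciRot p x 1 3 2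
def npLam (p : Params) (x : Point) : ℂ := ricciRot p x 1 3 3
def npπ (p : Params) (x : Point) : ℂ := ricciRot p x 1 3 0
def npε (p : Params) (x : Point) : ℂ := (ricciRot p x 1 0 0 + ricciRot p x 2 3 0) / 2
def npγ (p : Params) (x : Point) : ℂ := (ricciRot p x 1 0 1 + ricciRot p x 2 3 1) / 2
def npβ (p : Params) (x : Point) : ℂ := (ricciRot p x 1 0 2 + ricciRot p x 2 3 2) / 2
def npα (p : Params) (x : Point) : ℂ := (ricciRot p x 1 0 3 + ricciRot p x 2 3 3) / 2

/-! ### Two-spinors and the Dirac equation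

Spinor fields are given by their components in the spin dyad `(o, ι)` of the tetrad,
`l = o ō`, `n = ι ῑ`, `m = o ῑ`, `m̄ = ι ō`. -/

/-- A two-spinor field through its dyad components `P^{(0)}, P^{(1)}`. -/
abbrev Spinor := Fin 2 → Point → ℂ

/-- The number of the tetrad vector `σ_{A Ḃ}`: `00̇ ↦ l`, `01̇ ↦ m`, `10̇ ↦ m̄`, `11̇ ↦ n`. -/
def vecIdx (A B : Fin 2) : Fin 4 := (![![0, 2], ![3, 1]] : Fin 2 → Fin 2 → Fin 4) A B

/-- The antisymmetric spinor `ε^{AB} = ε_{AB}`, with `ε_{01} = 1`. -/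
def eps : Matrix (Fin 2) (Fin 2) ℂ := !![0, 1; -1, 0]

/-- The spin connection `Γ_{AB(c)} = - ½ ε^{ĊḊ} γ_{(AĊ)(BḊ)(c)}` of the Levi-Civita connection
in the dyad. -/
def spinConn (p : Params) (x : Point) (A B : Fin 2) (c : Fin 4) : ℂ :=
  -(1 / 2) * ∑ C, ∑ D, eps C D * ricciRot p x (vecIdx A C) (vecIdx B D) c

/-- Dyad components of the covariant derivative of a spinor along the tetrad vector `c`:
`∇_{(c)} P^C = e_{(c)}(P^C) + ε^{CE} Γ_{ED(c)} P^D`. -/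
def covDeriv (p : Params) (c : Fin 4) (P : Spinor) (C : Fin 2) (x : Point) : ℂ :=
  frameDeriv p c (P C) x + ∑ E, ∑ D, eps C E * spinConn p x E D c * P D x

/-- The tetrad component `e_{(c)}^i A_i` of the potential. -/
def potFrame (p : Params) (c : Fin 4) (x : Point) : ℂ :=
  ∑ i, tetrad p x c i * (potential p x i : ℂ)

/-- `(∇_{AḂ} + i q A_{AḂ}) P^A`. -/
def weylOp (p : Params) (q : ℝ) (P : Spinor) (B : Fin 2) (x : Point) : ℂ :=
  ∑ A, (covDeriv p (vecIdx A B) P A x + Complex.I * q * potFrame p (vecIdx A B) x * P A x)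

/-- The complex conjugate spinor, with components `Q̄^Ċ`. -/
def conjSpinor (Q : Spinor) : Spinor := fun C x => conj (Q C x)

/-- Lowering an index: `Q̄_Ḃ = Q̄^Ċ ε_{ĊḂ}`. -/
def lower (Q : Spinor) (B : Fin 2) (x : Point) : ℂ := ∑ C, Q C x * eps C B

/-- `(∇_{AḂ} + i q A_{AḂ}) P^A + i μ_* Q̄_Ḃ = 0` at `x`, for `Ḃ = 0̇, 1̇`. -/
def HalfDirac (p : Params) (q mass : ℝ) (P Q : Spinor) (x : Point) : Prop :=
  ∀ B : Fin 2, weylOp p q P B x + Complex.I * mass * lower (conjSpinor Q) B x = 0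

/-- The two-spinor form of the Dirac equation at `x` for a particle of charge `q` and mass
`mass = μ_*`. -/
def Dirac (p : Params) (q mass : ℝ) (P Q : Spinor) (x : Point) : Prop :=
  HalfDirac p q mass P Q x ∧ HalfDirac p (-q) mass Q P x

/-! ### Modes and separated equations -/

/-- `e^{i(mφ - ωt)}`. -/
def modePhase (m : ℝ) (ω : ℂ) (x : Point) : ℂ :=
  Complex.exp (Complex.I * (m * x 3 - ω * x 0))

/-- `K = m a - ω (r² + a²)`. -/
def K (p : Params) (m : ℝ) (ω : ℂ) (r : ℝ) : ℂ := m * p.a - ω * (r ^ 2 + p.a ^ 2)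

/-- `H = ω a sin θ - m / sin θ`. -/
def H (p : Params) (m : ℝ) (ω : ℂ) (θ : ℝ) : ℂ := ω * p.a * Real.sin θ - m / Real.sin θ

/-- The ansatz for `P`. -/
def ansatzP (p : Params) (m : ℝ) (ω : ℂ) (Rm Rp Sm Sp : ℝ → ℂ) : Spinor :=
  ![fun x => modePhase m ω x * Sm (x 2) * Rm (x 1) / ((√2 : ℝ) * conj (rhoBar p (x 1) (x 2))),
    fun x => modePhase m ω x * Sp (x 2) * Rp (x 1) / (√(Dr p (x 1)) : ℝ)]

/-- The ansatz for `Q̄`. -/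
def ansatzQbar (p : Params) (m : ℝ) (ω : ℂ) (Rm Rp Sm Sp : ℝ → ℂ) : Spinor :=
  ![fun x => -(modePhase m ω x * Sp (x 2) * Rm (x 1)) / ((√2 : ℝ) * rhoBar p (x 1) (x 2)),
    fun x => modePhase m ω x * Sm (x 2) * Rp (x 1) / (√(Dr p (x 1)) : ℝ)]

/-- The radial equations at `r`, with `R^{(-)} = Rm`, `R^{(+)} = Rp` and separation constant
`lam`. -/
def RadialEqs (p : Params) (q μ m : ℝ) (ω lam : ℂ) (Rm Rp : ℝ → ℂ) (r : ℝ) : Prop :=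
  ((√(Dr p r) : ℝ) : ℂ) *
      (deriv Rm r
        + Xi p * Complex.I * (m * p.a - ω * (r ^ 2 + p.a ^ 2)) / Dr p r * Rm r
        - Complex.I * q * p.e * r * Rm r / Dr p r)
    = (lam + Complex.I * μ * r) * Rp r ∧
  ((√(Dr p r) : ℝ) : ℂ) * deriv Rp r
      - Complex.I * Xi p * (m * p.a - ω * (r ^ 2 + p.a ^ 2)) * Rp r / (√(Dr p r) : ℝ)
      + Complex.I * p.e * q * r * Rp r / (√(Dr p r) : ℝ)
    = (lam - Complex.I * μ * r) * Rm r

/-- `d/dθ (√Δ_θ sin θ)`. -/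
def dSqrtSin (p : Params) (θ : ℝ) : ℝ := deriv (fun s : ℝ => √(Dθ p s) * Real.sin s) θ

/-- The angular equations at `θ`, with `S^{(-)} = Sm`, `S^{(+)} = Sp`. -/
def AngularEqs (p : Params) (μ m : ℝ) (ω lam : ℂ) (Sm Sp : ℝ → ℂ) (θ : ℝ) : Prop :=
  (Dθ p θ : ℂ) / (√(Dθ p θ) : ℝ) * deriv Sp θ
      + Xi p / (√(Dθ p θ) : ℝ) * (-(ω * p.a * Real.sin θ) + m / Real.sin θ) * Sp θ
      + 1 / (2 * Real.sin θ) * dSqrtSin p θ * Sp θ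
    = (-lam + μ * p.a * Real.cos θ) * Sm θ ∧
  (Dθ p θ : ℂ) / (√(Dθ p θ) : ℝ) * deriv Sm θ
      + (ω * p.a * Real.sin θ - m / Real.sin θ) * (Xi p / (√(Dθ p θ) : ℝ)) * Sm θ
      + 1 / (2 * Real.sin θ) * dSqrtSin p θ * Sm θ
    = (lam + μ * p.a * Real.cos θ) * Sp θ

/-! ### The Kerr–Newman equations (`Λ = 0`) -/

/-- `Δ = r² + a² + e² - 2 M r`. -/
def DKN (p : Params) (r : ℝ) : ℝ := r ^ 2 + p.a ^ 2 + p.e ^ 2 - 2 * p.M * r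

/-- The radial equations in Kerr–Newman spacetime. -/
def KNRadialEqs (p : Params) (q μ m : ℝ) (ω lam : ℂ) (Rm Rp : ℝ → ℂ) (r : ℝ) : Prop :=
  ((√(DKN p r) : ℝ) : ℂ) *
      (deriv Rm r
        + (Complex.I * m * p.a - Complex.I * ω * (r ^ 2 + p.a ^ 2)) / DKN p r * Rm r
        - Complex.I * q * p.e * r * Rm r / DKN p r)
    = (lam + Complex.I * μ * r) * Rp r ∧
  ((√(DKN p r) : ℝ) : ℂ) * deriv Rp r
      - Complex.I * (m * p.a - ω * (r ^ 2 + p.a ^ 2)) / (√(DKN p r) : ℝ) * Rp r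
      + Complex.I * p.e * q * r / (√(DKN p r) : ℝ) * Rp r
    = (lam - Complex.I * μ * r) * Rm r

/-- The angular equations in Kerr–Newman spacetime. -/
def KNAngularEqs (p : Params) (μ m : ℝ) (ω lam : ℂ) (Sm Sp : ℝ → ℂ) (θ : ℝ) : Prop :=
  deriv Sp θ
      + (m / Real.sin θ - ω * p.a * Real.sin θ + Real.cos θ / (2 * Real.sin θ)) * Sp θ
    = (-lam + μ * p.a * Real.cos θ) * Sm θ ∧
  deriv Sm θ
      + (ω * p.a * Real.sin θ - m / Real.sin θ + Real.cos θ / (2 * Real.sin θ)) * Sm θ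
    = (lam + μ * p.a * Real.cos θ) * Sp θ

/-- `(r² + a²) ω - m a + e q r`. -/
def KPage (p : Params) (q m : ℝ) (ω : ℂ) (r : ℝ) : ℂ :=
  (r ^ 2 + p.a ^ 2) * ω - m * p.a + p.e * q * r

/-- Page's second-order radial equation for `R = R^{(-)}`. -/
def PageRadial (p : Params) (q μ m : ℝ) (ω lam : ℂ) (R : ℝ → ℂ) (r : ℝ) : Prop :=
  DKN p r * deriv (deriv R) r
    + (r - p.M - Complex.I * μ * DKN p r / (lam + Complex.I * μ * r)) * deriv R r
    + ((KPage p q m ω r ^ 2 + Complex.I * (r - p.M) * KPage p q m ω r) / DKN p r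
        - 2 * Complex.I * ω * r - Complex.I * p.e * q
        - μ * KPage p q m ω r / (lam + Complex.I * μ * r) - μ ^ 2 * r ^ 2 - lam ^ 2) * R r
    = 0

/-- Page's second-order angular equation for `S = S^{(-)}`. -/
def PageAngular (p : Params) (μ m : ℝ) (ω lam : ℂ) (S : ℝ → ℂ) (θ : ℝ) : Prop :=
  (μ * p.a ^ 2 * ω * Real.sin θ ^ 2 * S θ - μ * p.a * m * S θ) / (lam + μ * p.a * Real.cos θ)
    + μ * p.a / 2 * Real.cos θ * S θ / (lam + μ * p.a * Real.cos θ)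
    + μ * p.a * Real.sin θ / (lam + μ * p.a * Real.cos θ) * deriv S θ
    + (deriv (deriv S) θ
        + (ω * p.a * Real.cos θ + m * Real.cos θ / Real.sin θ ^ 2) * S θ
        + Real.cos θ / (2 * Real.sin θ) * deriv S θ
        - 1 / 2 * S θ - 1 / 2 * (Real.cos θ ^ 2 / Real.sin θ ^ 2) * S θ)
    + (-(ω * p.a * Real.sin θ) + m / Real.sin θ) * (ω * p.a * Real.sin θ - m / Real.sin θ) * S θ
    + Real.cos θ / (2 * Real.sin θ) * deriv S θ
    + (1 / (2 * Real.sin θ) * Real.cos θ) ^ 2 * S θ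
    = (-lam ^ 2 + μ ^ 2 * p.a ^ 2 * Real.cos θ ^ 2) * S θ

end KNdS

end

noncomputable section

namespace KNdS

/-!
The coframe of the tetrad is spanned by the four metric-orthogonal one-forms `formT`, `formR`,
`formTheta` and `formPhi`, with coefficients depending on `r` and `θ` only, so Chandrasekhar's
symbols are the coefficients of the exterior derivatives of two kinds of one-forms,
`f dT + g dr` and `f dΦ + g dθ`; the spin coefficients follow by linear algebra.

On a field `e^{i(mφ - ωt)} f(r, θ)` the derivatives along `l`, `n` become Chandrasekhar's radial
operators `𝓓`, `𝓓†` and those along `m`, `m̄` his angular operators `𝓛`, `𝓛†`, the factors of the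
ansatz absorbing the spin coefficients. The Dirac equation then says that two rank-one matrices
agree, `𝓡(r) ⊗ S(θ) = R(r) ⊗ 𝓢(θ)`, where `𝓡` and `𝓢` collect the parts of the radial and angular
equations free of `λ`. The first spinor equation gives two of the four matrix entries, and charge
conjugation `(q, m, ω) ↦ (-q, -m, -ω̄)` turns the second one into the first. Comparing the rank-one
matrices at points where `R` and `S` do not vanish shows that `𝓡 = λ R` and `𝓢 = λ S` with the
same constant `λ`.

For `Λ = 0`, Page's equations arise by differentiating one equation of a first-order system and
eliminating the second unknown.
-/

lemma ofReal_eq_sqrt_sq {y : ℝ} (h : 0 ≤ y) : (y : ℂ) = ((√y : ℝ) : ℂ) ^ 2 :=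
  mod_cast (Real.sq_sqrt h).symm

lemma ofReal_sqrt_ne_zero {y : ℝ} (h : 0 < y) : ((√y : ℝ) : ℂ) ≠ 0 :=
  mod_cast (Real.sqrt_pos.2 h).ne'

lemma ofReal_sqrt_two_sq : ((√2 : ℝ) : ℂ) ^ 2 = 2 := mod_cast Real.sq_sqrt zero_le_two

lemma conj_rhoBar (p : Params) (r θ : ℝ) :
    conj (rhoBar p r θ) = r - Complex.I * p.a * Real.cos θ := by
  simp only [rhoBar, map_add, map_mul, Complex.conj_ofReal, Complex.conj_I]
  ring

lemma rhoBar_mul_conj (p : Params) (r θ : ℝ) :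
    rhoBar p r θ * conj (rhoBar p r θ) = (rhoSq p r θ : ℂ) := by
  rw [conj_rhoBar, rhoBar, rhoSq]
  push_cast
  linear_combination (-(p.a : ℂ) ^ 2 * Complex.cos θ ^ 2) * Complex.I_sq

lemma rhoBar_add_conj (p : Params) (r θ : ℝ) :
    rhoBar p r θ + conj (rhoBar p r θ) = 2 * r := by
  rw [conj_rhoBar, rhoBar]
  ring

lemma rhoBar_sub_conj (p : Params) (r θ : ℝ) :
    rhoBar p r θ - conj (rhoBar p r θ) = 2 * Complex.I * p.a * Real.cos θ := by
  rw [conj_rhoBar, rhoBar]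
  ring

lemma rhoBar_ne_zero {p : Params} {r θ : ℝ} (h : rhoSq p r θ ≠ 0) : rhoBar p r θ ≠ 0 :=
  left_ne_zero_of_mul (rhoBar_mul_conj p r θ ▸ Complex.ofReal_ne_zero.2 h)

lemma conj_rhoBar_ne_zero {p : Params} {r θ : ℝ} (h : rhoSq p r θ ≠ 0) :
    conj (rhoBar p r θ) ≠ 0 :=
  right_ne_zero_of_mul (rhoBar_mul_conj p r θ ▸ Complex.ofReal_ne_zero.2 h)

lemma sq_add_sq_eq_rhoSq_add (p : Params) (r θ : ℝ) :
    r ^ 2 + p.a ^ 2 = rhoSq p r θ + p.a ^ 2 * Real.sin θ ^ 2 := by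
  rw [rhoSq]
  linear_combination (-p.a ^ 2) * Real.sin_sq_add_cos_sq θ

lemma differentiable_Dr (p : Params) : Differentiable ℝ (Dr p) := by
  unfold Dr; fun_prop

lemma differentiable_Dθ (p : Params) : Differentiable ℝ (Dθ p) := by
  unfold Dθ; fun_prop

lemma hasDerivAt_rhoSq_r (p : Params) (r θ : ℝ) :
    HasDerivAt (fun s => rhoSq p s θ) (2 * r) r := by
  simpa [rhoSq] using (hasDerivAt_pow 2 r).add_const (p.a ^ 2 * Real.cos θ ^ 2)

lemma hasDerivAt_rhoSq_θ (p : Params) (r θ : ℝ) :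
    HasDerivAt (rhoSq p r) (-(2 * p.a ^ 2 * Real.sin θ * Real.cos θ)) θ := by
  have := (((Real.hasDerivAt_cos θ).fun_pow 2).const_mul (p.a ^ 2)).const_add (r ^ 2)
  exact this.congr_deriv (by ring)

lemma hasDerivAt_rhoBar_r (p : Params) (r θ : ℝ) :
    HasDerivAt (fun s => rhoBar p s θ) 1 r :=
  (Complex.ofRealCLM.hasDerivAt (x := r)).add_const _

lemma hasDerivAt_rhoBar_θ (p : Params) (r θ : ℝ) :
    HasDerivAt (rhoBar p r) (-(Complex.I * p.a * Real.sin θ)) θ := by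
  have := ((Real.hasDerivAt_cos θ).ofReal_comp.const_mul (Complex.I * p.a)).const_add (r : ℂ)
  exact this.congr_deriv (by push_cast; ring)

lemma hasDerivAt_conj_rhoBar_r (p : Params) (r θ : ℝ) :
    HasDerivAt (fun s => conj (rhoBar p s θ)) 1 r := by
  simpa only [RCLike.star_def, map_one] using (hasDerivAt_rhoBar_r p r θ).star

lemma hasDerivAt_conj_rhoBar_θ (p : Params) (r θ : ℝ) :
    HasDerivAt (fun s => conj (rhoBar p r s)) (Complex.I * p.a * Real.sin θ) θ := by
  simpa only [RCLike.star_def, map_neg, map_mul, Complex.conj_I, Complex.conj_ofReal, neg_mul,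
    neg_neg] using (hasDerivAt_rhoBar_θ p r θ).star

lemma hasDerivAt_sqrt_two_mul_Dθ_mul_sin {p : Params} {θ : ℝ} (h : 0 < Dθ p θ) :
    HasDerivAt (fun s => √(2 * Dθ p s) * Real.sin s) (√2 * dSqrtSin p θ) θ := by
  have h_diff : DifferentiableAt ℝ (fun s => √(Dθ p s) * Real.sin s) θ :=
    ((differentiable_Dθ p θ).sqrt h.ne').mul Real.differentiable_sin.differentiableAt
  simp only [Real.sqrt_mul zero_le_two, mul_assoc]
  exact h_diff.hasDerivAt.const_mul √2

/-- The points at which all coefficients of the metric and of the tetrad are finite and the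
tetrad is nondegenerate. -/
structure Regular (p : Params) (x : Point) : Prop where
  Xi_ne_zero : Xi p ≠ 0
  Dr_ne_zero : Dr p (x 1) ≠ 0
  sin_ne_zero : Real.sin (x 2) ≠ 0
  Dθ_pos : 0 < Dθ p (x 2)
  rhoSq_ne_zero : rhoSq p (x 1) (x 2) ≠ 0

lemma Regular.ofReal_ne_zero {p : Params} {x : Point} (h : Regular p x) :
    (Xi p : ℂ) ≠ 0 ∧ (Dr p (x 1) : ℂ) ≠ 0 ∧ (Real.sin (x 2) : ℂ) ≠ 0 ∧
      ((√(2 * Dθ p (x 2)) : ℝ) : ℂ) ≠ 0 ∧ (rhoSq p (x 1) (x 2) : ℂ) ≠ 0 :=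
  ⟨mod_cast h.Xi_ne_zero, mod_cast h.Dr_ne_zero, mod_cast h.sin_ne_zero,
    ofReal_sqrt_ne_zero (mul_pos two_pos h.Dθ_pos), mod_cast h.rhoSq_ne_zero⟩

lemma Regular.eventually {p : Params} {x : Point} (h : Regular p x) :
    ∀ᶠ y in nhds x, Regular p y := by
  have h_r : Continuous fun y : Point => y 1 := continuous_apply 1
  have h_θ : Continuous fun y : Point => y 2 := continuous_apply 2
  have h_Dr : Continuous fun y : Point => Dr p (y 1) := (differentiable_Dr p).continuous.comp h_r
  have h_Dθ : Continuous fun y : Point => Dθ p (y 2) := (differentiable_Dθ p).continuous.comp h_θ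
  have h_sin : Continuous fun y : Point => Real.sin (y 2) := Real.continuous_sin.comp h_θ
  have h_rho : Continuous fun y : Point => rhoSq p (y 1) (y 2) := by unfold rhoSq; fun_prop
  filter_upwards [h_Dr.continuousAt.eventually_ne h.Dr_ne_zero,
    h_sin.continuousAt.eventually_ne h.sin_ne_zero,
    h_Dθ.continuousAt.eventually (lt_mem_nhds h.Dθ_pos),
    h_rho.continuousAt.eventually_ne h.rhoSq_ne_zero] with y hDr hsin hDθ hrho
  exact ⟨h.Xi_ne_zero, hDr, hsin, hDθ, hrho⟩

lemma Regular.eventually_update {p : Params} {x : Point} (h : Regular p x) (j : Fin 4) :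
    ∀ᶠ s in nhds (x j), Regular p (Function.update x j s) := by
  have h_update : Filter.Tendsto (Function.update x j) (nhds (x j)) (nhds x) := by
    simpa using (continuous_const.update j continuous_id (f := fun _ => x)).tendsto (x j)
  exact h_update.eventually h.eventually

section Tetrad

lemma cast_Dθ_eq_sq_div_two {p : Params} {θ : ℝ} (h : 0 < Dθ p θ) :
    (Dθ p θ : ℂ) = ((√(2 * Dθ p θ) : ℝ) : ℂ) ^ 2 / 2 := by
  rw [← ofReal_eq_sqrt_sq (by positivity)]
  push_cast
  ring

/-- The value of the real one-form `η` on the complexified tangent vector `u`. -/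
def pairing (η : Fin 4 → ℝ) (u : Fin 4 → ℂ) : ℂ := ∑ i, (η i : ℂ) * u i

lemma sum_metric_mul (p : Params) (x : Point) (u : Fin 4 → ℂ) (i : Fin 4) :
    ∑ j, (metric p x i j : ℂ) * u j =
      (Dr p (x 1) / (Xi p ^ 2 * rhoSq p (x 1) (x 2)) : ℝ) * pairing (formT p x) u * formT p x i
        - (rhoSq p (x 1) (x 2) / Dr p (x 1) : ℝ) * u 1 * formR i
        - (rhoSq p (x 1) (x 2) / Dθ p (x 2) : ℝ) * u 2 * formTheta i
        - (Dθ p (x 2) * Real.sin (x 2) ^ 2 / (Xi p ^ 2 * rhoSq p (x 1) (x 2)) : ℝ)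
          * pairing (formPhi p x) u * formPhi p x i := by
  simp only [metric, pairing, Fin.sum_univ_four, formR, formTheta, Matrix.cons_val]
  push_cast
  ring

lemma sum_metric_mul_mul (p : Params) (x : Point) (u v : Fin 4 → ℂ) :
    ∑ i, ∑ j, (metric p x i j : ℂ) * u i * v j =
      Dr p (x 1) / (Xi p ^ 2 * rhoSq p (x 1) (x 2)) *
          (pairing (formT p x) u * pairing (formT p x) v)
        - rhoSq p (x 1) (x 2) / Dr p (x 1) * (u 1 * v 1)
        - rhoSq p (x 1) (x 2) / Dθ p (x 2) * (u 2 * v 2)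
        - Dθ p (x 2) * Real.sin (x 2) ^ 2 / (Xi p ^ 2 * rhoSq p (x 1) (x 2)) *
          (pairing (formPhi p x) u * pairing (formPhi p x) v) := by
  simp only [mul_right_comm _ (u _), ← Finset.sum_mul, sum_metric_mul]
  simp only [pairing, Fin.sum_univ_four, formR, formTheta, Matrix.cons_val]
  push_cast
  ring

variable {p : Params} {x : Point}

lemma tetrad_r (b : Fin 4) :
    tetrad p x b 1 = (![1, -Dr p (x 1) / (2 * rhoSq p (x 1) (x 2)), 0, 0] : Fin 4 → ℂ) b := by
  fin_cases b <;> simp [tetrad]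

lemma tetrad_θ (h : Regular p x) (b : Fin 4) :
    tetrad p x b 2 = ![0, 0, (√(2 * Dθ p (x 2)) : ℝ) / (2 * rhoBar p (x 1) (x 2)),
      (√(2 * Dθ p (x 2)) : ℝ) / (2 * conj (rhoBar p (x 1) (x 2)))] b := by
  obtain ⟨-, -, -, hw, -⟩ := h.ofReal_ne_zero
  have hww := cast_Dθ_eq_sq_div_two h.Dθ_pos
  fin_cases b
  · rfl
  · rfl
  all_goals
    simp only [tetrad, Matrix.cons_val, Fin.reduceFinMk]
    rw [hww]
    field_simp

lemma tetrad_φ (b : Fin 4) :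
    tetrad p x b 3 = (![p.a * Xi p / Dr p (x 1),
      p.a * Xi p / (2 * rhoSq p (x 1) (x 2)),
      Complex.I * Xi p / (rhoBar p (x 1) (x 2) * (√(2 * Dθ p (x 2)) : ℝ) * Real.sin (x 2)),
      -(Complex.I * Xi p) / (conj (rhoBar p (x 1) (x 2)) * (√(2 * Dθ p (x 2)) : ℝ) *
        Real.sin (x 2))] : Fin 4 → ℂ) b := by
  fin_cases b <;>
    simp only [tetrad, Matrix.cons_val, Fin.reduceFinMk, Fin.mk_zero, Fin.mk_one] <;>
    push_cast <;> ring

lemma pairing_formT_tetrad (h : Regular p x) (b : Fin 4) :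
    pairing (formT p x) (tetrad p x b) =
      (![Xi p * rhoSq p (x 1) (x 2) / Dr p (x 1), Xi p / 2, 0, 0] : Fin 4 → ℂ) b := by
  obtain ⟨-, -, -, -, hρ⟩ := h.ofReal_ne_zero
  fin_cases b <;>
    simp only [pairing, Fin.sum_univ_four, tetrad, formT, sq_add_sq_eq_rhoSq_add p _ (x 2),
      Matrix.cons_val, Fin.reduceFinMk, Fin.mk_zero, Fin.mk_one] <;>
    push_cast <;> simp only [← Complex.ofReal_sin] <;> field_simp <;> ring

lemma pairing_formPhi_tetrad (h : Regular p x) (b : Fin 4) :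
    pairing (formPhi p x) (tetrad p x b) =
      ![0, 0, -(Complex.I * Xi p * conj (rhoBar p (x 1) (x 2))) /
          ((√(2 * Dθ p (x 2)) : ℝ) * Real.sin (x 2)),
        Complex.I * Xi p * rhoBar p (x 1) (x 2) /
          ((√(2 * Dθ p (x 2)) : ℝ) * Real.sin (x 2))] b := by
  obtain ⟨-, -, hs, -⟩ := h.ofReal_ne_zero
  have hB := rhoBar_ne_zero h.rhoSq_ne_zero
  have hB' := conj_rhoBar_ne_zero h.rhoSq_ne_zero
  fin_cases b <;>
    simp only [pairing, Fin.sum_univ_four, tetrad, formPhi, sq_add_sq_eq_rhoSq_add p _ (x 2),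
      Matrix.cons_val, Fin.reduceFinMk, Fin.mk_zero, Fin.mk_one] <;>
    push_cast <;> simp only [← Complex.ofReal_sin, ← rhoBar_mul_conj]
  · ring
  · ring
  · field_simp
    ring
  · field_simp
    ring

lemma sum_metric_mul_tetrad (h : Regular p x) (b c : Fin 4) :
    ∑ i, ∑ j, (metric p x i j : ℂ) * tetrad p x b i * tetrad p x c j = nullEta b c := by
  obtain ⟨hX, hD, hs, hw, -⟩ := h.ofReal_ne_zero
  have hB' := conj_rhoBar_ne_zero h.rhoSq_ne_zero
  rw [sum_metric_mul_mul]
  simp only [pairing_formT_tetrad h, pairing_formPhi_tetrad h, tetrad_r, tetrad_θ h]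
  rw [cast_Dθ_eq_sq_div_two h.Dθ_pos]
  fin_cases b <;> fin_cases c <;>
    simp only [nullEta, Matrix.cons_val, Matrix.of_apply, Fin.reduceFinMk, Fin.mk_zero, Fin.mk_one,
      ← rhoBar_mul_conj] <;>
    field_simp <;> grind [Complex.I_sq]

end Tetrad

section Rotation

variable {p : Params} {x : Point}

lemma coTetrad_zero (h : Regular p x) (i : Fin 4) :
    coTetrad p 0 x i =
      (Xi p : ℂ)⁻¹ * formT p x i + -(rhoSq p (x 1) (x 2) / Dr p (x 1) : ℝ) * formR i := by
  obtain ⟨hX, hD, -, -, hρ⟩ := h.ofReal_ne_zero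
  rw [coTetrad, sum_metric_mul, pairing_formT_tetrad h, pairing_formPhi_tetrad h, tetrad_r,
    tetrad_θ h]
  simp only [Matrix.cons_val]
  push_cast
  field_simp
  ring

lemma coTetrad_one (h : Regular p x) (i : Fin 4) :
    coTetrad p 1 x i =
      (Dr p (x 1) / (2 * Xi p * rhoSq p (x 1) (x 2)) : ℝ) * formT p x i + 1 / 2 * formR i := by
  obtain ⟨hX, hD, -, -, hρ⟩ := h.ofReal_ne_zero
  rw [coTetrad, sum_metric_mul, pairing_formT_tetrad h, pairing_formPhi_tetrad h, tetrad_r,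
    tetrad_θ h]
  simp only [Matrix.cons_val]
  push_cast
  field_simp
  ring

lemma coTetrad_two (h : Regular p x) (i : Fin 4) :
    coTetrad p 2 x i =
      Complex.I * (√(2 * Dθ p (x 2)) * Real.sin (x 2) : ℝ) / (2 * Xi p * rhoBar p (x 1) (x 2)) *
          formPhi p x i
        + -(conj (rhoBar p (x 1) (x 2)) / (√(2 * Dθ p (x 2)) : ℝ)) * formTheta i := by
  obtain ⟨hX, -, -, hw, -⟩ := h.ofReal_ne_zero
  have hB := rhoBar_ne_zero h.rhoSq_ne_zero
  have hB' := conj_rhoBar_ne_zero h.rhoSq_ne_zero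
  rw [coTetrad, sum_metric_mul, pairing_formT_tetrad h, pairing_formPhi_tetrad h, tetrad_r,
    tetrad_θ h]
  simp only [Matrix.cons_val]
  push_cast
  rw [← rhoBar_mul_conj, cast_Dθ_eq_sq_div_two h.Dθ_pos, ← Complex.ofReal_sin]
  field_simp
  ring

lemma coTetrad_three (h : Regular p x) (i : Fin 4) :
    coTetrad p 3 x i =
      -(Complex.I * (√(2 * Dθ p (x 2)) * Real.sin (x 2) : ℝ)) /
          (2 * Xi p * conj (rhoBar p (x 1) (x 2))) * formPhi p x i
        + -(rhoBar p (x 1) (x 2) / (√(2 * Dθ p (x 2)) : ℝ)) * formTheta i := by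
  obtain ⟨hX, -, -, hw, -⟩ := h.ofReal_ne_zero
  have hB := rhoBar_ne_zero h.rhoSq_ne_zero
  have hB' := conj_rhoBar_ne_zero h.rhoSq_ne_zero
  rw [coTetrad, sum_metric_mul, pairing_formT_tetrad h, pairing_formPhi_tetrad h, tetrad_r,
    tetrad_θ h]
  simp only [Matrix.cons_val]
  push_cast
  rw [← rhoBar_mul_conj, cast_Dθ_eq_sq_div_two h.Dθ_pos, ← Complex.ofReal_sin]
  field_simp
  ring

lemma pd_eq_of_regular (h : Regular p x) {f g : Point → ℂ} (hfg : ∀ y, Regular p y → f y = g y)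
    (j : Fin 4) : pd j f x = pd j g x :=
  Filter.EventuallyEq.deriv_eq <| (h.eventually_update j).mono fun _ hs => hfg _ hs

lemma lambdaSymbol_of_formT_formR (h : Regular p x) {b : Fin 4} {f g : ℝ → ℝ → ℂ}
    (hb : ∀ y, Regular p y → ∀ i,
      coTetrad p b y i = f (y 1) (y 2) * formT p y i + g (y 1) (y 2) * formR i)
    {f_r f_θ g_θ : ℂ} (hfr : HasDerivAt (fun r => f r (x 2)) f_r (x 1))
    (hfθ : HasDerivAt (f (x 1)) f_θ (x 2)) (hgθ : HasDerivAt (g (x 1)) g_θ (x 2))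
    (a c : Fin 4) :
    lambdaSymbol p x a b c =
      f_r * (pairing (formT p x) (tetrad p x a) * tetrad p x c 1
          - pairing (formT p x) (tetrad p x c) * tetrad p x a 1)
        + f_θ * (pairing (formT p x) (tetrad p x a) * tetrad p x c 2
          - pairing (formT p x) (tetrad p x c) * tetrad p x a 2)
        - 2 * p.a * Real.sin (x 2) * Real.cos (x 2) * f (x 1) (x 2) *
          (tetrad p x a 3 * tetrad p x c 2 - tetrad p x c 3 * tetrad p x a 2)
        + g_θ * (tetrad p x a 1 * tetrad p x c 2 - tetrad p x c 1 * tetrad p x a 2) := by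
  have hsin : HasDerivAt (fun s : ℝ => f (x 1) s * (p.a * Complex.sin s ^ 2))
      (f_θ * (p.a * Complex.sin (x 2) ^ 2)
        + f (x 1) (x 2) * (p.a * (2 * Complex.sin (x 2) * Complex.cos (x 2)))) (x 2) := by
    have := (Complex.hasDerivAt_sin (x 2)).comp_ofReal.fun_pow 2
    simpa using hfθ.fun_mul (this.const_mul (p.a : ℂ))
  simp only [lambdaSymbol, Fin.sum_univ_four, pd_eq_of_regular h (fun y hy => hb y hy _)]
  simp only [pd, Fin.isValue, ne_eq, one_ne_zero, not_false_eq_true, Function.update_of_ne,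
    Fin.reduceEq, formT, Matrix.cons_val_zero, Complex.ofReal_one, mul_one, formR,
    Complex.ofReal_zero, mul_zero, add_zero, deriv_const', sub_self, Function.update_self,
    hfr.deriv, zero_add, hfθ.deriv, zero_mul, Matrix.cons_val_one, hgθ.deriv, Matrix.cons_val,
    Complex.ofReal_neg, Complex.ofReal_mul, Complex.ofReal_pow, Complex.ofReal_sin, mul_neg,
    deriv.fun_neg', deriv_mul_const_field', neg_mul, hsin.deriv, neg_add_rev, pairing,
    Fin.sum_univ_four, one_mul, Complex.ofReal_cos]
  ring

lemma lambdaSymbol_of_formPhi_formTheta (h : Regular p x) {b : Fin 4} {f g : ℝ → ℝ → ℂ}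
    (hb : ∀ y, Regular p y → ∀ i,
      coTetrad p b y i = f (y 1) (y 2) * formPhi p y i + g (y 1) (y 2) * formTheta i)
    {f_r f_θ g_r : ℂ} (hfr : HasDerivAt (fun r => f r (x 2)) f_r (x 1))
    (hfθ : HasDerivAt (f (x 1)) f_θ (x 2)) (hgr : HasDerivAt (fun r => g r (x 2)) g_r (x 1))
    (a c : Fin 4) :
    lambdaSymbol p x a b c =
      f_r * (pairing (formPhi p x) (tetrad p x a) * tetrad p x c 1
          - pairing (formPhi p x) (tetrad p x c) * tetrad p x a 1)
        + f_θ * (pairing (formPhi p x) (tetrad p x a) * tetrad p x c 2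
          - pairing (formPhi p x) (tetrad p x c) * tetrad p x a 2)
        - 2 * x 1 * f (x 1) (x 2) *
          (tetrad p x a 3 * tetrad p x c 1 - tetrad p x c 3 * tetrad p x a 1)
        + g_r * (tetrad p x a 2 * tetrad p x c 1 - tetrad p x c 2 * tetrad p x a 1) := by
  have hsq : HasDerivAt (fun s : ℝ => f s (x 2) * (-(p.a : ℂ) ^ 2 + -(s : ℂ) ^ 2))
      (f_r * (-(p.a : ℂ) ^ 2 + -(x 1 : ℂ) ^ 2) + f (x 1) (x 2) * -(2 * x 1)) (x 1) := by
    have := (Complex.ofRealCLM.hasDerivAt (x := x 1)).fun_pow 2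
    simpa using hfr.fun_mul (this.fun_neg.const_add (-(p.a : ℂ) ^ 2))
  simp only [lambdaSymbol, Fin.sum_univ_four, pd_eq_of_regular h (fun y hy => hb y hy _)]
  simp only [pd, Fin.isValue, ne_eq, one_ne_zero, not_false_eq_true, Function.update_of_ne,
    Fin.reduceEq, formPhi, neg_add_rev, Matrix.cons_val_zero, formTheta, Complex.ofReal_zero,
    mul_zero, add_zero, differentiableAt_const, deriv_fun_mul, deriv_const', zero_mul, sub_self,
    Function.update_self, deriv_mul_const_field', hfr.deriv, zero_add, hfθ.deriv,
    Matrix.cons_val_one, Matrix.cons_val, Complex.ofReal_add, Complex.ofReal_neg,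
    Complex.ofReal_pow, Complex.ofReal_one, mul_one, hgr.deriv, deriv_fun_add, hsq.deriv, mul_neg,
    pairing, Fin.sum_univ_four]
  ring

lemma lambdaSymbol_zero (h : Regular p x) (a c : Fin 4) :
    lambdaSymbol p x a 0 c =
      2 * p.a * Real.sin (x 2) * Real.cos (x 2) / Xi p *
          (tetrad p x a 2 * tetrad p x c 3 - tetrad p x c 2 * tetrad p x a 3)
        + 2 * p.a ^ 2 * Real.sin (x 2) * Real.cos (x 2) / Dr p (x 1) *
          (tetrad p x a 1 * tetrad p x c 2 - tetrad p x c 1 * tetrad p x a 2) := by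
  rw [lambdaSymbol_of_formT_formR h (f := fun _ _ => (Xi p : ℂ)⁻¹)
    (g := fun r θ => -(rhoSq p r θ / Dr p r : ℝ)) (fun y hy i => coTetrad_zero hy i)
    (hasDerivAt_const _ _) (hasDerivAt_const _ _)
    ((hasDerivAt_rhoSq_θ p (x 1) (x 2)).div_const (Dr p (x 1))).ofReal_comp.fun_neg]
  push_cast
  ring

lemma lambdaSymbol_one (h : Regular p x) (a c : Fin 4) :
    lambdaSymbol p x a 1 c =
      Dr p (x 1) / (2 * Xi p * rhoSq p (x 1) (x 2)) *
        (((deriv (Dr p) (x 1) : ℝ) / Dr p (x 1) - 2 * x 1 / rhoSq p (x 1) (x 2)) *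
            (pairing (formT p x) (tetrad p x a) * tetrad p x c 1
              - pairing (formT p x) (tetrad p x c) * tetrad p x a 1)
          + 2 * p.a ^ 2 * Real.sin (x 2) * Real.cos (x 2) / rhoSq p (x 1) (x 2) *
            (pairing (formT p x) (tetrad p x a) * tetrad p x c 2
              - pairing (formT p x) (tetrad p x c) * tetrad p x a 2)
          + 2 * p.a * Real.sin (x 2) * Real.cos (x 2) *
            (tetrad p x a 2 * tetrad p x c 3 - tetrad p x c 2 * tetrad p x a 3)) := by
  obtain ⟨hX, hD, -, -, hρ⟩ := h.ofReal_ne_zero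
  have h_ne : 2 * Xi p * rhoSq p (x 1) (x 2) ≠ 0 :=
    mul_ne_zero (mul_ne_zero two_ne_zero h.Xi_ne_zero) h.rhoSq_ne_zero
  rw [lambdaSymbol_of_formT_formR h (f := fun r θ => (Dr p r / (2 * Xi p * rhoSq p r θ) : ℝ))
    (g := fun _ _ => 1 / 2) (fun y hy i => coTetrad_one hy i)
    ((differentiable_Dr p (x 1)).hasDerivAt.fun_div
      ((hasDerivAt_rhoSq_r p (x 1) (x 2)).const_mul (2 * Xi p)) h_ne).ofReal_comp
    ((hasDerivAt_const _ _).fun_div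
      ((hasDerivAt_rhoSq_θ p (x 1) (x 2)).const_mul (2 * Xi p)) h_ne).ofReal_comp
    (hasDerivAt_const _ _)]
  push_cast
  field_simp
  ring

lemma lambdaSymbol_two (h : Regular p x) (a c : Fin 4) :
    lambdaSymbol p x a 2 c =
      Complex.I / (2 * Xi p * rhoBar p (x 1) (x 2)) *
        ((√2 * dSqrtSin p (x 2)
              + Complex.I * p.a * Real.sin (x 2) / rhoBar p (x 1) (x 2) *
                ((√(2 * Dθ p (x 2)) : ℝ) * Real.sin (x 2))) *
            (pairing (formPhi p x) (tetrad p x a) * tetrad p x c 2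
              - pairing (formPhi p x) (tetrad p x c) * tetrad p x a 2)
          - (√(2 * Dθ p (x 2)) : ℝ) * Real.sin (x 2) *
            ((pairing (formPhi p x) (tetrad p x a) * tetrad p x c 1
                - pairing (formPhi p x) (tetrad p x c) * tetrad p x a 1) /
                  rhoBar p (x 1) (x 2)
              + 2 * x 1 * (tetrad p x a 3 * tetrad p x c 1 - tetrad p x c 3 * tetrad p x a 1)))
        - (tetrad p x a 2 * tetrad p x c 1 - tetrad p x c 2 * tetrad p x a 1) /
          (√(2 * Dθ p (x 2)) : ℝ) := by
  obtain ⟨hX, -, -, hw, -⟩ := h.ofReal_ne_zero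
  have hB := rhoBar_ne_zero h.rhoSq_ne_zero
  have h_ne : 2 * (Xi p : ℂ) * rhoBar p (x 1) (x 2) ≠ 0 :=
    mul_ne_zero (mul_ne_zero two_ne_zero hX) hB
  rw [lambdaSymbol_of_formPhi_formTheta h
    (f := fun r θ => Complex.I * (√(2 * Dθ p θ) * Real.sin θ : ℝ) / (2 * Xi p * rhoBar p r θ))
    (g := fun r θ => -(conj (rhoBar p r θ) / (√(2 * Dθ p θ) : ℝ)))
    (fun y hy i => coTetrad_two hy i)
    ((hasDerivAt_const _ _).fun_div
      ((hasDerivAt_rhoBar_r p (x 1) (x 2)).const_mul (2 * Xi p : ℂ)) h_ne)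
    (((hasDerivAt_sqrt_two_mul_Dθ_mul_sin h.Dθ_pos).ofReal_comp.const_mul Complex.I).fun_div
      ((hasDerivAt_rhoBar_θ p (x 1) (x 2)).const_mul (2 * Xi p : ℂ)) h_ne)
    ((hasDerivAt_conj_rhoBar_r p (x 1) (x 2)).div_const _).fun_neg]
  push_cast
  field_simp
  ring

lemma lambdaSymbol_three (h : Regular p x) (a c : Fin 4) :
    lambdaSymbol p x a 3 c =
      -(Complex.I / (2 * Xi p * conj (rhoBar p (x 1) (x 2)))) *
        ((√2 * dSqrtSin p (x 2)
              - Complex.I * p.a * Real.sin (x 2) / conj (rhoBar p (x 1) (x 2)) *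
                ((√(2 * Dθ p (x 2)) : ℝ) * Real.sin (x 2))) *
            (pairing (formPhi p x) (tetrad p x a) * tetrad p x c 2
              - pairing (formPhi p x) (tetrad p x c) * tetrad p x a 2)
          - (√(2 * Dθ p (x 2)) : ℝ) * Real.sin (x 2) *
            ((pairing (formPhi p x) (tetrad p x a) * tetrad p x c 1
                - pairing (formPhi p x) (tetrad p x c) * tetrad p x a 1) /
                  conj (rhoBar p (x 1) (x 2))
              + 2 * x 1 * (tetrad p x a 3 * tetrad p x c 1 - tetrad p x c 3 * tetrad p x a 1)))
        - (tetrad p x a 2 * tetrad p x c 1 - tetrad p x c 2 * tetrad p x a 1) /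
          (√(2 * Dθ p (x 2)) : ℝ) := by
  obtain ⟨hX, -, -, hw, -⟩ := h.ofReal_ne_zero
  have hB' := conj_rhoBar_ne_zero h.rhoSq_ne_zero
  have h_ne : 2 * (Xi p : ℂ) * conj (rhoBar p (x 1) (x 2)) ≠ 0 :=
    mul_ne_zero (mul_ne_zero two_ne_zero hX) hB'
  rw [lambdaSymbol_of_formPhi_formTheta h
    (f := fun r θ => -(Complex.I * (√(2 * Dθ p θ) * Real.sin θ : ℝ)) /
      (2 * Xi p * conj (rhoBar p r θ)))
    (g := fun r θ => -(rhoBar p r θ / (√(2 * Dθ p θ) : ℝ)))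
    (fun y hy i => coTetrad_three hy i)
    ((hasDerivAt_const _ _).fun_div
      ((hasDerivAt_conj_rhoBar_r p (x 1) (x 2)).const_mul (2 * Xi p : ℂ)) h_ne)
    (((hasDerivAt_sqrt_two_mul_Dθ_mul_sin h.Dθ_pos).ofReal_comp.const_mul
      Complex.I).fun_neg.fun_div
      ((hasDerivAt_conj_rhoBar_θ p (x 1) (x 2)).const_mul (2 * Xi p : ℂ)) h_ne)
    ((hasDerivAt_rhoBar_r p (x 1) (x 2)).div_const _).fun_neg]
  push_cast
  field_simp
  ring

end Rotation

section SpinCoefficients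

variable {p : Params} {x : Point}

lemma npκ_eq_zero (h : Regular p x) : npκ p x = 0 := by
  obtain ⟨hX, -⟩ := h.ofReal_ne_zero
  simp only [npκ, ricciRot, lambdaSymbol_zero h, lambdaSymbol_two h, pairing_formPhi_tetrad h,
    tetrad_r, tetrad_θ h, tetrad_φ, Matrix.cons_val, ← rhoBar_mul_conj, mul_zero, zero_mul,
    zero_div, sub_zero, zero_sub, add_zero, sub_self]
  field_simp
  ring

lemma npσ_eq_zero (h : Regular p x) : npσ p x = 0 := by
  obtain ⟨hX, -, hs, -⟩ := h.ofReal_ne_zero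
  have h_add := rhoBar_add_conj p (x 1) (x 2)
  simp only [npσ, ricciRot, lambdaSymbol_zero h, lambdaSymbol_two h, pairing_formPhi_tetrad h,
    tetrad_r, tetrad_θ h, tetrad_φ, Matrix.cons_val, ← rhoBar_mul_conj, mul_zero, zero_mul,
    sub_zero, zero_sub, add_zero, zero_add, sub_self]
  field_simp
  grind [Complex.I_sq]

lemma npν_eq_zero (h : Regular p x) : npν p x = 0 := by
  simp only [npν, ricciRot, lambdaSymbol_one h, lambdaSymbol_three h, pairing_formT_tetrad h,
    pairing_formPhi_tetrad h, tetrad_r, tetrad_θ h, tetrad_φ, Matrix.cons_val, ← rhoBar_mul_conj,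
    mul_zero, zero_mul, zero_div, sub_zero, zero_sub, add_zero, zero_add, sub_self]
  field_simp
  ring

lemma npLam_eq_zero (h : Regular p x) : npLam p x = 0 := by
  obtain ⟨hX, -, hs, -⟩ := h.ofReal_ne_zero
  have h_add := rhoBar_add_conj p (x 1) (x 2)
  simp only [npLam, ricciRot, lambdaSymbol_one h, lambdaSymbol_three h, pairing_formT_tetrad h,
    pairing_formPhi_tetrad h, tetrad_r, tetrad_θ h, tetrad_φ, Matrix.cons_val, ← rhoBar_mul_conj,
    mul_zero, zero_mul, sub_zero, zero_sub, add_zero, sub_self]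
  field_simp
  grind [Complex.I_sq]

lemma npε_eq_zero (h : Regular p x) : npε p x = 0 := by
  obtain ⟨hX, -, hs, -⟩ := h.ofReal_ne_zero
  have hB' := conj_rhoBar_ne_zero h.rhoSq_ne_zero
  have h_sub := rhoBar_sub_conj p (x 1) (x 2)
  simp only [npε, ricciRot, lambdaSymbol_zero h, lambdaSymbol_one h, lambdaSymbol_two h,
    lambdaSymbol_three h, pairing_formT_tetrad h, pairing_formPhi_tetrad h, tetrad_r, tetrad_θ h,
    tetrad_φ, Matrix.cons_val, ← rhoBar_mul_conj, mul_zero, zero_mul, zero_div, sub_zero,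
    zero_sub, add_zero, zero_add, sub_self]
  field_simp
  grind [Complex.I_sq]

lemma npπ_eq (h : Regular p x) :
    npπ p x = 1 / 2 * (Complex.I * p.a * Real.sin (x 2) * (√(2 * Dθ p (x 2)) : ℝ) /
      conj (rhoBar p (x 1) (x 2)) ^ 2) := by
  obtain ⟨hX, hD, -⟩ := h.ofReal_ne_zero
  have h_add := rhoBar_add_conj p (x 1) (x 2)
  have h_sub := rhoBar_sub_conj p (x 1) (x 2)
  simp only [npπ, ricciRot, lambdaSymbol_zero h, lambdaSymbol_one h, lambdaSymbol_three h,
    pairing_formT_tetrad h, pairing_formPhi_tetrad h, tetrad_r, tetrad_θ h, tetrad_φ,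
    Matrix.cons_val, ← rhoBar_mul_conj, mul_zero, zero_mul, zero_div, sub_zero, zero_sub,
    zero_add, sub_self]
  field_simp
  grind [Complex.I_sq]

lemma npβ_eq (h : Regular p x) :
    npβ p x = 1 / (2 * Real.sin (x 2) * (√2 : ℝ) * rhoBar p (x 1) (x 2)) * dSqrtSin p (x 2) := by
  obtain ⟨hX, hD, hs, hw, -⟩ := h.ofReal_ne_zero
  have hB := rhoBar_ne_zero h.rhoSq_ne_zero
  have hB' := conj_rhoBar_ne_zero h.rhoSq_ne_zero
  have h_add := rhoBar_add_conj p (x 1) (x 2)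
  have h_sub := rhoBar_sub_conj p (x 1) (x 2)
  have h_sqrt := ofReal_sqrt_two_sq
  simp only [npβ, ricciRot, lambdaSymbol_zero h, lambdaSymbol_one h, lambdaSymbol_two h,
    lambdaSymbol_three h, pairing_formT_tetrad h, pairing_formPhi_tetrad h, tetrad_r, tetrad_θ h,
    tetrad_φ, Matrix.cons_val, ← rhoBar_mul_conj, mul_zero, zero_mul, zero_div, sub_zero,
    zero_sub, add_zero, zero_add, sub_self]
  field_simp
  clear hX hD hs hw hB hB'
  grind [Complex.I_sq]

lemma npγ_eq (h : Regular p x) :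
    npγ p x = 1 / (4 * rhoSq p (x 1) (x 2)) * (deriv (Dr p) (x 1) : ℝ) -
      1 / (2 * rhoSq p (x 1) (x 2) * conj (rhoBar p (x 1) (x 2))) * Dr p (x 1) := by
  obtain ⟨hX, hD, hs, hw, -⟩ := h.ofReal_ne_zero
  have hB := rhoBar_ne_zero h.rhoSq_ne_zero
  have hB' := conj_rhoBar_ne_zero h.rhoSq_ne_zero
  have h_add := rhoBar_add_conj p (x 1) (x 2)
  have h_sub := rhoBar_sub_conj p (x 1) (x 2)
  simp only [npγ, ricciRot, lambdaSymbol_zero h, lambdaSymbol_one h, lambdaSymbol_two h,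
    lambdaSymbol_three h, pairing_formT_tetrad h, pairing_formPhi_tetrad h, tetrad_r, tetrad_θ h,
    tetrad_φ, Matrix.cons_val, ← rhoBar_mul_conj, mul_zero, zero_mul, sub_zero, zero_sub,
    add_zero, zero_add, sub_self]
  field_simp
  grind [Complex.I_sq]

lemma npρ_eq (h : Regular p x) : npρ p x = -1 / conj (rhoBar p (x 1) (x 2)) := by
  obtain ⟨hX, -, hs, hw, -⟩ := h.ofReal_ne_zero
  have h_add := rhoBar_add_conj p (x 1) (x 2)
  have h_sub := rhoBar_sub_conj p (x 1) (x 2)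
  simp only [npρ, ricciRot, lambdaSymbol_zero h, lambdaSymbol_two h, lambdaSymbol_three h,
    pairing_formPhi_tetrad h, tetrad_r, tetrad_θ h, tetrad_φ, Matrix.cons_val, ← rhoBar_mul_conj,
    mul_zero, zero_mul, sub_zero, zero_sub, add_zero, sub_self]
  field_simp
  grind [Complex.I_sq]

lemma npμ_eq (h : Regular p x) :
    npμ p x = -Dr p (x 1) / (2 * rhoSq p (x 1) (x 2) * conj (rhoBar p (x 1) (x 2))) := by
  obtain ⟨hX, -, hs, hw, -⟩ := h.ofReal_ne_zero
  have h_add := rhoBar_add_conj p (x 1) (x 2)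
  have h_sub := rhoBar_sub_conj p (x 1) (x 2)
  simp only [npμ, ricciRot, lambdaSymbol_one h, lambdaSymbol_two h, lambdaSymbol_three h,
    pairing_formT_tetrad h, pairing_formPhi_tetrad h, tetrad_r, tetrad_θ h, tetrad_φ,
    Matrix.cons_val, ← rhoBar_mul_conj, mul_zero, zero_mul, sub_zero, zero_sub, add_zero,
    zero_add, sub_self]
  field_simp
  grind [Complex.I_sq]

lemma npτ_eq (h : Regular p x) :
    npτ p x = -Complex.I * (√(2 * Dθ p (x 2)) : ℝ) * p.a * Real.sin (x 2) /
      (2 * rhoSq p (x 1) (x 2)) := by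
  obtain ⟨hX, hD, -⟩ := h.ofReal_ne_zero
  have h_add := rhoBar_add_conj p (x 1) (x 2)
  have h_sub := rhoBar_sub_conj p (x 1) (x 2)
  simp only [npτ, ricciRot, lambdaSymbol_zero h, lambdaSymbol_one h, lambdaSymbol_two h,
    pairing_formT_tetrad h, pairing_formPhi_tetrad h, tetrad_r, tetrad_θ h, tetrad_φ,
    Matrix.cons_val, ← rhoBar_mul_conj, mul_zero, zero_mul, zero_div, sub_zero, zero_sub,
    zero_add, sub_self]
  field_simp
  grind [Complex.I_sq]

lemma npα_eq (h : Regular p x) : npα p x = npπ p x - conj (npβ p x) := by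
  obtain ⟨hX, hD, hs, hw, -⟩ := h.ofReal_ne_zero
  have hB := rhoBar_ne_zero h.rhoSq_ne_zero
  have hB' := conj_rhoBar_ne_zero h.rhoSq_ne_zero
  have h_add := rhoBar_add_conj p (x 1) (x 2)
  have h_sub := rhoBar_sub_conj p (x 1) (x 2)
  have h_sqrt := ofReal_sqrt_two_sq
  rw [npπ_eq h, npβ_eq h]
  simp only [map_mul, map_div₀, map_one, map_ofNat, Complex.conj_ofReal]
  simp only [npα, ricciRot, lambdaSymbol_zero h, lambdaSymbol_one h, lambdaSymbol_two h,
    lambdaSymbol_three h, pairing_formT_tetrad h, pairing_formPhi_tetrad h, tetrad_r, tetrad_θ h,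
    tetrad_φ, Matrix.cons_val, ← rhoBar_mul_conj, mul_zero, zero_mul, zero_div, sub_zero,
    zero_sub, add_zero, zero_add, sub_self]
  field_simp
  clear hX hD hs hw hB hB'
  grind [Complex.I_sq]

end SpinCoefficients

section DiracComponents

lemma lambdaSymbol_swap (p : Params) (x : Point) (a b c : Fin 4) :
    lambdaSymbol p x c b a = -lambdaSymbol p x a b c := by
  simp only [lambdaSymbol, ← Finset.sum_neg_distrib]
  refine Finset.sum_congr rfl fun i _ => Finset.sum_congr rfl fun j _ => ?_
  ring

lemma ricciRot_swap (p : Params) (x : Point) (a b c : Fin 4) :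
    ricciRot p x b a c = -ricciRot p x a b c := by
  rw [ricciRot, ricciRot, lambdaSymbol_swap p x a c b, lambdaSymbol_swap p x a b c,
    lambdaSymbol_swap p x c a b]
  ring

lemma ricciRot_self (p : Params) (x : Point) (a c : Fin 4) : ricciRot p x a a c = 0 :=
  self_eq_neg.1 (ricciRot_swap p x a a c)

lemma halfDirac_iff (p : Params) (x : Point) (q mass : ℝ) (P Q : Spinor) :
    HalfDirac p q mass P Q x ↔
      (frameDeriv p 1 (P 1) x + (-npγ p x + npμ p x + Complex.I * q * potFrame p 1 x) * P 1 x
          + (frameDeriv p 2 (P 0) x + (-npτ p x + npβ p x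
            + Complex.I * q * potFrame p 2 x) * P 0 x)
        = -Complex.I * mass * conj (Q 0 x)) ∧
      (-frameDeriv p 0 (P 0) x + (npρ p x - npε p x - Complex.I * q * potFrame p 0 x) * P 0 x
          + (-frameDeriv p 3 (P 1) x + (npα p x - npπ p x
            - Complex.I * q * potFrame p 3 x) * P 1 x)
        = -Complex.I * mass * conj (Q 1 x)) := by
  rw [HalfDirac, Fin.forall_fin_two, and_comm]
  simp only [weylOp, covDeriv, spinConn, lower, conjSpinor, Fin.sum_univ_two, eps, vecIdx,
    Matrix.of_apply, Matrix.cons_val, ricciRot_self, ricciRot_swap p x 2 0, ricciRot_swap p x 1 3,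
    ricciRot_swap p x 1 0, ricciRot_swap p x 2 3, npγ, npμ, npτ, npβ, npρ, npε, npα, npπ]
  constructor
  · rintro ⟨h_one, h_zero⟩
    exact ⟨by linear_combination h_one, by linear_combination -h_zero⟩
  · rintro ⟨h_one, h_zero⟩
    exact ⟨by linear_combination h_one, by linear_combination -h_zero⟩

end DiracComponents

section Modes

lemma modePhase_ne_zero (m : ℝ) (ω : ℂ) (x : Point) : modePhase m ω x ≠ 0 :=
  Complex.exp_ne_zero _

lemma pd_mul_comp_r_θ (g : Point → ℂ) (f : ℝ → ℝ → ℂ) (x : Point) {j : Fin 4}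
    (hr : j ≠ 1) (hθ : j ≠ 2) :
    pd j (fun y => g y * f (y 1) (y 2)) x = pd j g x * f (x 1) (x 2) := by
  simp only [pd, Function.update_of_ne hr.symm, Function.update_of_ne hθ.symm,
    deriv_mul_const_field]

lemma pd_zero_modePhase (m : ℝ) (ω : ℂ) (x : Point) :
    pd 0 (modePhase m ω) x = modePhase m ω x * -(Complex.I * ω) := by
  have h_exponent : HasDerivAt (fun t : ℝ => Complex.I * (m * x 3 - ω * t))
      (-(Complex.I * ω)) (x 0) :=
    ((((Complex.ofRealCLM.hasDerivAt (x := x 0)).const_mul ω).const_sub _).const_mul _).congr_deriv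
      (by simp)
  exact h_exponent.cexp.deriv

lemma pd_three_modePhase (m : ℝ) (ω : ℂ) (x : Point) :
    pd 3 (modePhase m ω) x = modePhase m ω x * (Complex.I * m) := by
  have h_exponent : HasDerivAt (fun φ : ℝ => Complex.I * (m * φ - ω * x 0))
      (Complex.I * m) (x 3) :=
    ((((Complex.ofRealCLM.hasDerivAt (x := x 3)).const_mul (m : ℂ)).sub_const _).const_mul
      _).congr_deriv (by simp)
  exact h_exponent.cexp.deriv

lemma frameDeriv_mode (p : Params) (c : Fin 4) (m : ℝ) (ω : ℂ) (f : ℝ → ℝ → ℂ) (x : Point) :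
    frameDeriv p c (fun y => modePhase m ω y * f (y 1) (y 2)) x =
      modePhase m ω x * (tetrad p x c 1 * deriv (fun r => f r (x 2)) (x 1)
        + tetrad p x c 2 * deriv (f (x 1)) (x 2)
        + Complex.I * (m * tetrad p x c 3 - ω * tetrad p x c 0) * f (x 1) (x 2)) := by
  have h_r : pd 1 (fun y => modePhase m ω y * f (y 1) (y 2)) x =
      modePhase m ω x * deriv (fun r => f r (x 2)) (x 1) :=
    deriv_const_mul_field (modePhase m ω x)
  have h_θ : pd 2 (fun y => modePhase m ω y * f (y 1) (y 2)) x =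
      modePhase m ω x * deriv (f (x 1)) (x 2) :=
    deriv_const_mul_field (modePhase m ω x)
  simp only [frameDeriv, Fin.sum_univ_four, h_r, h_θ,
    pd_mul_comp_r_θ _ _ _ (show (0 : Fin 4) ≠ 1 by decide) (by decide),
    pd_mul_comp_r_θ _ _ _ (show (3 : Fin 4) ≠ 1 by decide) (by decide),
    pd_zero_modePhase, pd_three_modePhase]
  ring

variable {p : Params} {x : Point}

lemma frameDeriv_zero_mode (m : ℝ) (ω : ℂ) (f : ℝ → ℝ → ℂ) :
    frameDeriv p 0 (fun y => modePhase m ω y * f (y 1) (y 2)) x =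
      modePhase m ω x * (deriv (fun r => f r (x 2)) (x 1) +
        Complex.I * Xi p / Dr p (x 1) * K p m ω (x 1) * f (x 1) (x 2)) := by
  simp only [frameDeriv_mode, tetrad, K, Matrix.cons_val]
  push_cast
  ring

lemma frameDeriv_one_mode (h : Regular p x) (m : ℝ) (ω : ℂ) (f : ℝ → ℝ → ℂ) :
    frameDeriv p 1 (fun y => modePhase m ω y * f (y 1) (y 2)) x =
      modePhase m ω x * (-Dr p (x 1) / (2 * rhoSq p (x 1) (x 2)) *
        (deriv (fun r => f r (x 2)) (x 1) -
          Complex.I * Xi p * K p m ω (x 1) / Dr p (x 1) * f (x 1) (x 2))) := by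
  obtain ⟨-, hD, -⟩ := h.ofReal_ne_zero
  simp only [frameDeriv_mode, tetrad, K, Matrix.cons_val]
  push_cast
  field_simp
  ring

lemma sqrt_two_mul_Dθ (p : Params) (θ : ℝ) :
    ((√(2 * Dθ p θ) : ℝ) : ℂ) = (√2 : ℝ) * (√(Dθ p θ) : ℝ) := by
  rw [Real.sqrt_mul zero_le_two, Complex.ofReal_mul]

lemma frameDeriv_two_mode (h : Regular p x) (m : ℝ) (ω : ℂ) (f : ℝ → ℝ → ℂ) :
    frameDeriv p 2 (fun y => modePhase m ω y * f (y 1) (y 2)) x =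
      modePhase m ω x *
        ((√(Dθ p (x 2)) : ℝ) / ((√2 : ℝ) * rhoBar p (x 1) (x 2)) *
        (deriv (f (x 1)) (x 2) + Xi p * H p m ω (x 2) / Dθ p (x 2) * f (x 1) (x 2))) := by
  have h_sq : (Dθ p (x 2) : ℂ) = ((√(Dθ p (x 2)) : ℝ) : ℂ) ^ 2 := ofReal_eq_sqrt_sq h.Dθ_pos.le
  simp only [frameDeriv_mode, tetrad, H, Matrix.cons_val]
  rw [sqrt_two_mul_Dθ, h_sq]
  field_simp
  grind [Complex.I_sq]

lemma frameDeriv_three_mode (h : Regular p x) (m : ℝ) (ω : ℂ) (f : ℝ → ℝ → ℂ) :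
    frameDeriv p 3 (fun y => modePhase m ω y * f (y 1) (y 2)) x =
      modePhase m ω x *
        ((√(Dθ p (x 2)) : ℝ) / ((√2 : ℝ) * conj (rhoBar p (x 1) (x 2))) *
        (deriv (f (x 1)) (x 2) - Xi p * H p m ω (x 2) / Dθ p (x 2) * f (x 1) (x 2))) := by
  have h_sq : (Dθ p (x 2) : ℂ) = ((√(Dθ p (x 2)) : ℝ) : ℂ) ^ 2 := ofReal_eq_sqrt_sq h.Dθ_pos.le
  simp only [frameDeriv_mode, tetrad, H, Matrix.cons_val]
  rw [sqrt_two_mul_Dθ, h_sq]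
  field_simp
  grind [Complex.I_sq]

lemma potFrame_eq_pairing (p : Params) (c : Fin 4) (x : Point) :
    potFrame p c x =
      -(p.e * x 1) / (Xi p * rhoSq p (x 1) (x 2)) * pairing (formT p x) (tetrad p x c) := by
  simp only [potFrame, potential, pairing, rhoSq, Finset.mul_sum]
  refine Finset.sum_congr rfl fun i _ => ?_
  push_cast
  ring

lemma potFrame_eq (h : Regular p x) (c : Fin 4) :
    potFrame p c x = (![-(p.e * x 1) / Dr p (x 1),
      -(p.e * x 1) / (2 * rhoSq p (x 1) (x 2)), 0, 0] : Fin 4 → ℂ) c := by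
  obtain ⟨hX, -, -, -, hρ⟩ := h.ofReal_ne_zero
  rw [potFrame_eq_pairing, pairing_formT_tetrad h]
  fin_cases c <;>
    simp only [Matrix.cons_val, Fin.reduceFinMk, Fin.mk_zero, Fin.mk_one, mul_zero] <;> field_simp

end Modes

/-- Chandrasekhar's radial operator `𝓓 = ∂_r + i (Ξ K - q e r) / Δ_r`. Its adjoint `𝓓†` is
`radialD p (-q) (-m) (-ω)`. -/
def radialD (p : Params) (q m : ℝ) (ω : ℂ) (R : ℝ → ℂ) (r : ℝ) : ℂ :=
  deriv R r + Complex.I * (Xi p * K p m ω r - q * p.e * r) / Dr p r * R r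

/-- Chandrasekhar's angular operator
`𝓛 = √Δ_θ (∂_θ + Ξ H / Δ_θ) + (2 sin θ)⁻¹ d(√Δ_θ sin θ)/dθ`. Its adjoint `𝓛†` is
`angularL p (-m) (-ω)`. -/
def angularL (p : Params) (m : ℝ) (ω : ℂ) (S : ℝ → ℂ) (θ : ℝ) : ℂ :=
  (√(Dθ p θ) : ℝ) * (deriv S θ + Xi p * H p m ω θ / Dθ p θ * S θ)
    + dSqrtSin p θ / (2 * Real.sin θ) * S θ

section Ansatz

variable {p : Params} {x : Point} {m : ℝ} {ω : ℂ} {Rm Rp Sm Sp : ℝ → ℂ}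

lemma ansatzP_zero_eq : ansatzP p m ω Rm Rp Sm Sp 0 = fun y =>
    modePhase m ω y * (Sm (y 2) * Rm (y 1) / ((√2 : ℝ) * conj (rhoBar p (y 1) (y 2)))) := by
  funext y
  simp only [ansatzP, Matrix.cons_val]
  ring

lemma ansatzP_one_eq : ansatzP p m ω Rm Rp Sm Sp 1 = fun y =>
    modePhase m ω y * (Sp (y 2) * Rp (y 1) / (√(Dr p (y 1)) : ℝ)) := by
  funext y
  simp only [ansatzP, Matrix.cons_val]
  ring

lemma frameDeriv_zero_ansatzP (h : Regular p x) (q : ℝ) (hR : DifferentiableAt ℝ Rm (x 1)) :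
    -frameDeriv p 0 (ansatzP p m ω Rm Rp Sm Sp 0) x + (npρ p x - npε p x
        - Complex.I * q * potFrame p 0 x) * ansatzP p m ω Rm Rp Sm Sp 0 x
      = -(modePhase m ω x * Sm (x 2) * radialD p q m ω Rm (x 1)
        / ((√2 : ℝ) * conj (rhoBar p (x 1) (x 2)))) := by
  obtain ⟨-, hD, -⟩ := h.ofReal_ne_zero
  have hB' := conj_rhoBar_ne_zero h.rhoSq_ne_zero
  have h_two : ((√2 : ℝ) : ℂ) ≠ 0 := ofReal_sqrt_ne_zero two_pos
  have h_deriv := ((hR.hasDerivAt.const_mul (Sm (x 2))).fun_div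
    ((hasDerivAt_conj_rhoBar_r p (x 1) (x 2)).const_mul ((√2 : ℝ) : ℂ))
    (mul_ne_zero h_two hB')).deriv
  have h_frame := frameDeriv_zero_mode (p := p) (x := x) m ω
    fun r θ => Sm θ * Rm r / ((√2 : ℝ) * conj (rhoBar p r θ))
  simp only [h_deriv] at h_frame
  simp only [ansatzP_zero_eq, h_frame, npρ_eq h, npε_eq_zero h, potFrame_eq h, Matrix.cons_val,
    radialD]
  field_simp
  ring

lemma frameDeriv_one_ansatzP (h : Regular p x) (hΔ : 0 < Dr p (x 1)) (q : ℝ)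
    (hR : DifferentiableAt ℝ Rp (x 1)) :
    frameDeriv p 1 (ansatzP p m ω Rm Rp Sm Sp 1) x + (-npγ p x + npμ p x
        + Complex.I * q * potFrame p 1 x) * ansatzP p m ω Rm Rp Sm Sp 1 x
      = -(modePhase m ω x * Sp (x 2) * ((√(Dr p (x 1)) : ℝ) * radialD p (-q) (-m) (-ω) Rp (x 1))
        / (2 * rhoSq p (x 1) (x 2))) := by
  obtain ⟨-, -, -, -, hρ⟩ := h.ofReal_ne_zero
  have h_sqrt : ((√(Dr p (x 1)) : ℝ) : ℂ) ≠ 0 := ofReal_sqrt_ne_zero hΔ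
  have h_sq : (Dr p (x 1) : ℂ) = ((√(Dr p (x 1)) : ℝ) : ℂ) ^ 2 := ofReal_eq_sqrt_sq hΔ.le
  have h_deriv := ((hR.hasDerivAt.const_mul (Sp (x 2))).fun_div
    (((differentiable_Dr p).differentiableAt.hasDerivAt.sqrt hΔ.ne').ofReal_comp) h_sqrt).deriv
  have h_frame := frameDeriv_one_mode h m ω
    fun r θ => Sp θ * Rp r / (√(Dr p r) : ℝ)
  simp only [h_deriv] at h_frame
  simp only [ansatzP_one_eq, h_frame, npγ_eq h, npμ_eq h, potFrame_eq h, Matrix.cons_val,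
    radialD, K]
  push_cast
  rw [h_sq]
  field_simp
  ring

lemma frameDeriv_two_ansatzP (h : Regular p x) (q : ℝ) (hS : DifferentiableAt ℝ Sm (x 2)) :
    frameDeriv p 2 (ansatzP p m ω Rm Rp Sm Sp 0) x + (-npτ p x + npβ p x
        + Complex.I * q * potFrame p 2 x) * ansatzP p m ω Rm Rp Sm Sp 0 x
      = modePhase m ω x * Rm (x 1) * angularL p m ω Sm (x 2) / (2 * rhoSq p (x 1) (x 2)) := by
  obtain ⟨-, -, hs, -⟩ := h.ofReal_ne_zero
  have hB' := conj_rhoBar_ne_zero h.rhoSq_ne_zero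
  have h_two : ((√2 : ℝ) : ℂ) ≠ 0 := ofReal_sqrt_ne_zero two_pos
  have h_deriv := ((hS.hasDerivAt.mul_const (Rm (x 1))).fun_div
    ((hasDerivAt_conj_rhoBar_θ p (x 1) (x 2)).const_mul ((√2 : ℝ) : ℂ))
    (mul_ne_zero h_two hB')).deriv
  have h_frame := frameDeriv_two_mode h m ω
    fun r θ => Sm θ * Rm r / ((√2 : ℝ) * conj (rhoBar p r θ))
  simp only [h_deriv] at h_frame
  simp only [ansatzP_zero_eq, h_frame, npτ_eq h, npβ_eq h, potFrame_eq h, Matrix.cons_val,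
    sqrt_two_mul_Dθ, angularL, ← rhoBar_mul_conj, mul_zero, add_zero]
  field_simp
  rw [ofReal_sqrt_two_sq]
  ring

lemma frameDeriv_three_ansatzP (h : Regular p x) (q : ℝ) (hS : DifferentiableAt ℝ Sp (x 2)) :
    -frameDeriv p 3 (ansatzP p m ω Rm Rp Sm Sp 1) x + (npα p x - npπ p x
        - Complex.I * q * potFrame p 3 x) * ansatzP p m ω Rm Rp Sm Sp 1 x
      = -(modePhase m ω x * Rp (x 1) * angularL p (-m) (-ω) Sp (x 2)
        / ((√(Dr p (x 1)) : ℝ) * ((√2 : ℝ) * conj (rhoBar p (x 1) (x 2))))) := by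
  have h_deriv := ((hS.hasDerivAt.mul_const (Rp (x 1))).div_const
    ((√(Dr p (x 1)) : ℝ) : ℂ)).deriv
  have h_frame := frameDeriv_three_mode h m ω
    fun r θ => Sp θ * Rp r / (√(Dr p r) : ℝ)
  simp only [h_deriv] at h_frame
  simp only [ansatzP_one_eq, h_frame, npα_eq h, npβ_eq h, potFrame_eq h, Matrix.cons_val,
    angularL, H, map_mul, map_div₀, map_one, map_ofNat, Complex.conj_ofReal]
  push_cast
  ring

end Ansatz

/-- The part of the radial equations free of the separation constant `λ`: they say that it equals
`λ (R⁺, R⁻)`. -/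
def radialOp (p : Params) (q μ m : ℝ) (ω : ℂ) (Rm Rp : ℝ → ℂ) (r : ℝ) : Fin 2 → ℂ :=
  ![(√(Dr p r) : ℝ) * radialD p q m ω Rm r - Complex.I * μ * r * Rp r,
    (√(Dr p r) : ℝ) * radialD p (-q) (-m) (-ω) Rp r + Complex.I * μ * r * Rm r]

/-- The part of the angular equations free of the separation constant `λ`: they say that it equals
`λ (S⁻, S⁺)`. -/
def angularOp (p : Params) (μ m : ℝ) (ω : ℂ) (Sm Sp : ℝ → ℂ) (θ : ℝ) : Fin 2 → ℂ :=
  ![-(angularL p (-m) (-ω) Sp θ - μ * p.a * Real.cos θ * Sm θ),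
    angularL p m ω Sm θ - μ * p.a * Real.cos θ * Sp θ]

section SeparatedEquations

variable {p : Params} {r θ : ℝ}

lemma radialEqs_iff_radialOp_eq_smul (h : 0 < Dr p r) (q μ m : ℝ) (ω lam : ℂ) (Rm Rp : ℝ → ℂ) :
    RadialEqs p q μ m ω lam Rm Rp r ↔
      radialOp p q μ m ω Rm Rp r = lam • ![Rp r, Rm r] := by
  have h_sq : (Dr p r : ℂ) = ((√(Dr p r) : ℝ) : ℂ) ^ 2 := ofReal_eq_sqrt_sq h.le
  simp only [RadialEqs, radialOp, radialD, K, funext_iff, Fin.forall_fin_two, Pi.smul_apply,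
    Matrix.cons_val, smul_eq_mul, h_sq]
  push_cast
  refine and_congr ⟨fun h => ?_, fun h => ?_⟩ ⟨fun h => ?_, fun h => ?_⟩ <;> grind

lemma angularEqs_iff_angularOp_eq_smul (h : 0 < Dθ p θ) (μ m : ℝ) (ω lam : ℂ)
    (Sm Sp : ℝ → ℂ) :
    AngularEqs p μ m ω lam Sm Sp θ ↔ angularOp p μ m ω Sm Sp θ = lam • ![Sm θ, Sp θ] := by
  have h_sq : (Dθ p θ : ℂ) = ((√(Dθ p θ) : ℝ) : ℂ) ^ 2 := ofReal_eq_sqrt_sq h.le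
  simp only [AngularEqs, angularOp, angularL, H, funext_iff, Fin.forall_fin_two, Pi.smul_apply,
    Matrix.cons_val, smul_eq_mul, h_sq]
  push_cast
  refine and_congr ⟨fun h => ?_, fun h => ?_⟩ ⟨fun h => ?_, fun h => ?_⟩ <;> grind

end SeparatedEquations

section ChargeConjugation

lemma conj_modePhase (m : ℝ) (ω : ℂ) (x : Point) :
    conj (modePhase m ω x) = modePhase (-m) (-conj ω) x := by
  rw [modePhase, modePhase, ← Complex.exp_conj]
  congr 1
  simp only [map_mul, map_sub, Complex.conj_I, Complex.conj_ofReal]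
  push_cast
  ring

lemma conj_radialD (p : Params) (q m : ℝ) (ω : ℂ) (R : ℝ → ℂ) (r : ℝ) :
    conj (radialD p q m ω R r) = radialD p (-q) (-m) (-conj ω) (fun s => conj (R s)) r := by
  have h_deriv : deriv (fun s => conj (R s)) r = conj (deriv R r) := deriv.star
  simp only [radialD, K, h_deriv, map_add, map_sub, map_mul, map_div₀, map_pow, Complex.conj_I,
    Complex.conj_ofReal]
  push_cast
  ring

lemma radialD_neg (p : Params) (q m : ℝ) (ω : ℂ) (R : ℝ → ℂ) (r : ℝ) :
    radialD p q m ω (fun s => -R s) r = -radialD p q m ω R r := by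
  simp only [radialD, deriv.fun_neg]
  ring

lemma conj_angularL (p : Params) (m : ℝ) (ω : ℂ) (S : ℝ → ℂ) (θ : ℝ) :
    conj (angularL p m ω S θ) = angularL p m (conj ω) (fun s => conj (S s)) θ := by
  have h_deriv : deriv (fun s => conj (S s)) θ = conj (deriv S θ) := deriv.star
  simp only [angularL, H, h_deriv, map_add, map_sub, map_mul, map_div₀, map_ofNat,
    Complex.conj_ofReal]

variable (p : Params) (q μ m : ℝ) (ω : ℂ) (Rm Rp Sm Sp : ℝ → ℂ)

lemma radialOp_chargeConj (r : ℝ) :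
    radialOp p (-q) μ (-m) (-conj ω) (fun s => -conj (Rm s)) (fun s => conj (Rp s)) r =
      ![-conj (radialOp p q μ m ω Rm Rp r 0), conj (radialOp p q μ m ω Rm Rp r 1)] := by
  simp only [radialOp, Matrix.cons_val, map_add, map_sub, map_mul, Complex.conj_I,
    Complex.conj_ofReal, conj_radialD, radialD_neg, map_neg, neg_neg]
  ring_nf

lemma angularOp_chargeConj (θ : ℝ) :
    angularOp p μ (-m) (-conj ω) (fun s => conj (Sp s)) (fun s => conj (Sm s)) θ =
      ![-conj (angularOp p μ m ω Sm Sp θ 1), -conj (angularOp p μ m ω Sm Sp θ 0)] := by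
  simp only [angularOp, Matrix.cons_val, map_sub, map_mul, Complex.conj_ofReal, conj_angularL,
    map_neg, neg_neg]

lemma conjSpinor_ansatzQbar : conjSpinor (ansatzQbar p m ω Rm Rp Sm Sp) =
    ansatzP p (-m) (-conj ω) (fun s => -conj (Rm s)) (fun s => conj (Rp s))
      (fun s => conj (Sp s)) fun s => conj (Sm s) := by
  funext A x
  fin_cases A <;>
    simp only [conjSpinor, ansatzQbar, ansatzP, Matrix.cons_val, Fin.mk_zero, Fin.mk_one,
      map_neg, map_mul, map_div₀, conj_modePhase, Complex.conj_ofReal, mul_neg]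

lemma ansatzP_eq_conjSpinor : ansatzP p m ω Rm Rp Sm Sp =
    conjSpinor (ansatzQbar p (-m) (-conj ω) (fun s => -conj (Rm s)) (fun s => conj (Rp s))
      (fun s => conj (Sp s)) fun s => conj (Sm s)) := by
  simp only [conjSpinor_ansatzQbar, map_neg, neg_neg, Complex.conj_conj]

end ChargeConjugation

section Separation

variable {p : Params} {x : Point} {Rm Rp Sm Sp : ℝ → ℂ}

lemma halfDirac_ansatz_iff (h : Regular p x) (hΔ : 0 < Dr p (x 1)) (q μ m : ℝ) (ω : ℂ)
    (hRm : DifferentiableAt ℝ Rm (x 1)) (hRp : DifferentiableAt ℝ Rp (x 1))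
    (hSm : DifferentiableAt ℝ Sm (x 2)) (hSp : DifferentiableAt ℝ Sp (x 2)) :
    HalfDirac p q (μ / √2) (ansatzP p m ω Rm Rp Sm Sp)
        (conjSpinor (ansatzQbar p m ω Rm Rp Sm Sp)) x ↔
      radialOp p q μ m ω Rm Rp (x 1) 1 * Sp (x 2) = Rm (x 1) * angularOp p μ m ω Sm Sp (x 2) 1 ∧
      radialOp p q μ m ω Rm Rp (x 1) 0 * Sm (x 2) =
        Rp (x 1) * angularOp p μ m ω Sm Sp (x 2) 0 := by
  have hB := rhoBar_ne_zero h.rhoSq_ne_zero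
  have hB' := conj_rhoBar_ne_zero h.rhoSq_ne_zero
  have h_phase := modePhase_ne_zero m ω x
  have h_sqrt : ((√(Dr p (x 1)) : ℝ) : ℂ) ≠ 0 := ofReal_sqrt_ne_zero hΔ
  have h_mass : Complex.I * conj (rhoBar p (x 1) (x 2)) =
      Complex.I * x 1 + p.a * Real.cos (x 2) := by
    rw [conj_rhoBar]
    linear_combination (-(p.a : ℂ) * Real.cos (x 2)) * Complex.I_sq
  rw [halfDirac_iff, frameDeriv_zero_ansatzP h q hRm, frameDeriv_one_ansatzP h hΔ q hRp,
    frameDeriv_two_ansatzP h q hSm, frameDeriv_three_ansatzP h q hSp]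
  simp only [conjSpinor, ansatzQbar, Complex.conj_conj, Matrix.cons_val, radialOp, angularOp,
    ← rhoBar_mul_conj, Complex.ofReal_div]
  constructor
  · rintro ⟨h_one, h_zero⟩
    field_simp at h_one h_zero
    rw [ofReal_sqrt_two_sq] at h_one
    constructor
    · linear_combination (-1 / 2) * h_one - μ * Sp (x 2) * Rm (x 1) * h_mass
    · linear_combination -h_zero + μ * Sm (x 2) * Rp (x 1) * h_mass
  · rintro ⟨h_one, h_zero⟩
    constructor
    · field_simp
      rw [ofReal_sqrt_two_sq]
      linear_combination -2 * h_one - 2 * μ * Sp (x 2) * Rm (x 1) * h_mass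
    · field_simp
      linear_combination -h_zero + μ * Sm (x 2) * Rp (x 1) * h_mass

lemma dirac_ansatz_iff_vecMulVec_eq (h : Regular p x) (hΔ : 0 < Dr p (x 1)) (q μ m : ℝ) (ω : ℂ)
    (hRm : DifferentiableAt ℝ Rm (x 1)) (hRp : DifferentiableAt ℝ Rp (x 1))
    (hSm : DifferentiableAt ℝ Sm (x 2)) (hSp : DifferentiableAt ℝ Sp (x 2)) :
    Dirac p q (μ / √2) (ansatzP p m ω Rm Rp Sm Sp)
        (conjSpinor (ansatzQbar p m ω Rm Rp Sm Sp)) x ↔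
      Matrix.vecMulVec (radialOp p q μ m ω Rm Rp (x 1)) ![Sm (x 2), Sp (x 2)] =
        Matrix.vecMulVec ![Rp (x 1), Rm (x 1)] (angularOp p μ m ω Sm Sp (x 2)) := by
  have h_conj : HalfDirac p (-q) (μ / √2) (conjSpinor (ansatzQbar p m ω Rm Rp Sm Sp))
      (ansatzP p m ω Rm Rp Sm Sp) x ↔
      radialOp p q μ m ω Rm Rp (x 1) 1 * Sm (x 2) = Rm (x 1) * angularOp p μ m ω Sm Sp (x 2) 0 ∧
      radialOp p q μ m ω Rm Rp (x 1) 0 * Sp (x 2) =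
        Rp (x 1) * angularOp p μ m ω Sm Sp (x 2) 1 := by
    have h_swap := halfDirac_ansatz_iff h hΔ (-q) μ (-m) (-conj ω)
      (Rm := fun s => -conj (Rm s)) (Rp := fun s => conj (Rp s)) (Sm := fun s => conj (Sp s))
      (Sp := fun s => conj (Sm s)) hRm.star.fun_neg hRp.star hSp.star hSm.star
    rw [← conjSpinor_ansatzQbar, ← ansatzP_eq_conjSpinor, radialOp_chargeConj,
      angularOp_chargeConj] at h_swap
    simpa only [Matrix.cons_val, mul_neg, neg_mul, neg_neg, neg_inj, ← map_mul,
      (starRingEnd ℂ).injective.eq_iff] using h_swap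
  rw [Dirac, halfDirac_ansatz_iff h hΔ q μ m ω hRm hRp hSm hSp, h_conj]
  simp only [← Matrix.ext_iff, Fin.forall_fin_two, Matrix.vecMulVec_apply, Matrix.cons_val]
  tauto

lemma exists_smul_of_vecMulVec_eq {α β ι κ F : Type*} [Field F] {I : Set α} {J : Set β}
    {A R : α → ι → F} {S B : β → κ → F} (hR : ∃ r ∈ I, R r ≠ 0) (hS : ∃ θ ∈ J, S θ ≠ 0)
    (h : ∀ r ∈ I, ∀ θ ∈ J, Matrix.vecMulVec (A r) (S θ) = Matrix.vecMulVec (R r) (B θ)) :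
    ∃ lam : F, (∀ r ∈ I, A r = lam • R r) ∧ ∀ θ ∈ J, B θ = lam • S θ := by
  have h_entry : ∀ r ∈ I, ∀ θ ∈ J, ∀ i j, A r i * S θ j = R r i * B θ j :=
    fun r hr θ hθ i j => congrFun₂ (h r hr θ hθ) i j
  obtain ⟨r₀, hr₀, hR₀⟩ := hR
  obtain ⟨θ₀, hθ₀, hS₀⟩ := hS
  obtain ⟨i₀, hi₀⟩ := Function.ne_iff.1 hR₀
  obtain ⟨j₀, hj₀⟩ := Function.ne_iff.1 hS₀
  have hB : ∀ θ ∈ J, B θ = (A r₀ i₀ / R r₀ i₀) • S θ := fun θ hθ => funext fun j => by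
    rw [Pi.smul_apply, smul_eq_mul, div_mul_eq_mul_div, eq_div_iff hi₀,
      h_entry r₀ hr₀ θ hθ, mul_comm]
  refine ⟨A r₀ i₀ / R r₀ i₀, fun r hr => funext fun i => mul_right_cancel₀ hj₀ ?_, hB⟩
  rw [h_entry r hr θ₀ hθ₀, hB θ₀ hθ₀, Pi.smul_apply, Pi.smul_apply, smul_eq_mul, smul_eq_mul]
  ring

lemma dirac_ansatz_of_separated {q μ m : ℝ} {ω lam : ℂ} (h : Regular p x) (hΔ : 0 < Dr p (x 1))
    (hRm : DifferentiableAt ℝ Rm (x 1)) (hRp : DifferentiableAt ℝ Rp (x 1))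
    (hSm : DifferentiableAt ℝ Sm (x 2)) (hSp : DifferentiableAt ℝ Sp (x 2))
    (h_radial : RadialEqs p q μ m ω lam Rm Rp (x 1))
    (h_angular : AngularEqs p μ m ω lam Sm Sp (x 2)) :
    Dirac p q (μ / √2) (ansatzP p m ω Rm Rp Sm Sp)
      (conjSpinor (ansatzQbar p m ω Rm Rp Sm Sp)) x := by
  rw [dirac_ansatz_iff_vecMulVec_eq h hΔ q μ m ω hRm hRp hSm hSp,
    (radialEqs_iff_radialOp_eq_smul hΔ ..).1 h_radial,
    (angularEqs_iff_angularOp_eq_smul h.Dθ_pos ..).1 h_angular,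
    Matrix.smul_vecMulVec, Matrix.vecMulVec_smul]

lemma exists_separation_constant {q μ m : ℝ} {ω : ℂ} {I J : Set ℝ}
    (h : ∀ x : Point, x 1 ∈ I → x 2 ∈ J → Regular p x) (hΔr : ∀ r ∈ I, 0 < Dr p r)
    (hΔθ : ∀ θ ∈ J, 0 < Dθ p θ)
    (hR : ∀ r ∈ I, DifferentiableAt ℝ Rm r ∧ DifferentiableAt ℝ Rp r)
    (hS : ∀ θ ∈ J, DifferentiableAt ℝ Sm θ ∧ DifferentiableAt ℝ Sp θ)
    (hR_ne : ∃ r ∈ I, Rm r ≠ 0 ∨ Rp r ≠ 0) (hS_ne : ∃ θ ∈ J, Sm θ ≠ 0 ∨ Sp θ ≠ 0)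
    (h_dirac : ∀ x : Point, x 1 ∈ I → x 2 ∈ J → Dirac p q (μ / √2) (ansatzP p m ω Rm Rp Sm Sp)
      (conjSpinor (ansatzQbar p m ω Rm Rp Sm Sp)) x) :
    ∃ lam : ℂ, (∀ r ∈ I, RadialEqs p q μ m ω lam Rm Rp r) ∧
      ∀ θ ∈ J, AngularEqs p μ m ω lam Sm Sp θ := by
  have hR_vec : ∃ r ∈ I, ![Rp r, Rm r] ≠ 0 := hR_ne.imp fun r hr => hr.imp_right fun h_or h_zero =>
    h_or.elim (· (congrFun h_zero 1)) (· (congrFun h_zero 0))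
  have hS_vec : ∃ θ ∈ J, ![Sm θ, Sp θ] ≠ 0 := hS_ne.imp fun θ hθ => hθ.imp_right fun h_or h_zero =>
    h_or.elim (· (congrFun h_zero 0)) (· (congrFun h_zero 1))
  obtain ⟨lam, h_radial, h_angular⟩ := exists_smul_of_vecMulVec_eq hR_vec hS_vec
    fun r hr θ hθ => (dirac_ansatz_iff_vecMulVec_eq (h ![0, r, θ, 0] hr hθ) (hΔr r hr) q μ m ω
      (hR r hr).1 (hR r hr).2 (hS θ hθ).1 (hS θ hθ).2).1 (h_dirac ![0, r, θ, 0] hr hθ)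
  exact ⟨lam, fun r hr => (radialEqs_iff_radialOp_eq_smul (hΔr r hr) ..).2 (h_radial r hr),
    fun θ hθ => (angularEqs_iff_angularOp_eq_smul (hΔθ θ hθ) ..).2 (h_angular θ hθ)⟩

end Separation

section KerrNewman

variable {p : Params} {q μ m : ℝ} {ω lam : ℂ} {Rm Rp Sm Sp : ℝ → ℂ} {r θ : ℝ}

lemma Xi_of_Λ_eq_zero (h : p.Λ = 0) : Xi p = 1 := by simp [Xi, h]

lemma Dr_of_Λ_eq_zero (h : p.Λ = 0) : Dr p = DKN p := by
  funext r
  simp only [Dr, DKN, h]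
  ring

lemma Dθ_of_Λ_eq_zero (h : p.Λ = 0) : Dθ p θ = 1 := by simp [Dθ, h]

lemma dSqrtSin_of_Λ_eq_zero (h : p.Λ = 0) : dSqrtSin p θ = Real.cos θ := by
  simp [dSqrtSin, Dθ_of_Λ_eq_zero h]

lemma radialEqs_iff_KNRadialEqs (h : p.Λ = 0) :
    RadialEqs p q μ m ω lam Rm Rp r ↔ KNRadialEqs p q μ m ω lam Rm Rp r := by
  rw [RadialEqs, KNRadialEqs, Dr_of_Λ_eq_zero h, Xi_of_Λ_eq_zero h]
  refine and_congr (Eq.congr_left ?_) (Eq.congr_left ?_) <;> push_cast <;> ring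

lemma angularEqs_iff_KNAngularEqs (h : p.Λ = 0) :
    AngularEqs p μ m ω lam Sm Sp θ ↔ KNAngularEqs p μ m ω lam Sm Sp θ := by
  rw [AngularEqs, KNAngularEqs, Dθ_of_Λ_eq_zero h, Xi_of_Λ_eq_zero h, dSqrtSin_of_Λ_eq_zero h,
    Real.sqrt_one]
  refine and_congr (Eq.congr_left ?_) (Eq.congr_left ?_) <;> push_cast <;> ring

end KerrNewman

lemma hasDerivAt_deriv_of_first_order_system {𝕜 A : Type*} [NontriviallyNormedField 𝕜]
    [NormedCommRing A] [NormedAlgebra 𝕜 A] {u v α β : 𝕜 → A} {α' γ δ ℓ : A} {x : 𝕜}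
    (hu : DifferentiableAt 𝕜 u x) (h_deriv : ∀ᶠ y in nhds x, deriv u y = α y * u y + β y * v y)
    (hv : HasDerivAt v (γ * u x + δ * v x) x) (hα : HasDerivAt α α' x)
    (hβ : HasDerivAt β (ℓ * β x) x) :
    HasDerivAt (deriv u)
      ((α x + δ + ℓ) * deriv u x + (α' + β x * γ - α x * δ - α x * ℓ) * u x) x := by
  refine (((hα.mul hu.hasDerivAt).add (hβ.mul hv)).congr_of_eventuallyEq h_deriv).congr_deriv ?_
  linear_combination (-(δ + ℓ)) * h_deriv.self_of_nhds

section SecondOrder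

variable {p : Params} {q μ m : ℝ} {ω lam : ℂ} {Rm Rp Sm Sp : ℝ → ℂ} {r θ : ℝ}

lemma KNRadialEqs.deriv_eq (hΔ : 0 < DKN p r) (h : KNRadialEqs p q μ m ω lam Rm Rp r) :
    deriv Rm r = Complex.I * KPage p q m ω r / DKN p r * Rm r
      + (lam + Complex.I * μ * r) / (√(DKN p r) : ℝ) * Rp r ∧
    deriv Rp r = (lam - Complex.I * μ * r) / (√(DKN p r) : ℝ) * Rm r
      + -(Complex.I * KPage p q m ω r / DKN p r) * Rp r := by
  have h_sqrt : ((√(DKN p r) : ℝ) : ℂ) ≠ 0 := ofReal_sqrt_ne_zero hΔ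
  have h_sq : (DKN p r : ℂ) = ((√(DKN p r) : ℝ) : ℂ) ^ 2 := ofReal_eq_sqrt_sq hΔ.le
  obtain ⟨h_minus, h_plus⟩ := h
  rw [h_sq] at h_minus ⊢
  rw [KPage]
  field_simp at h_minus h_plus ⊢
  exact ⟨by linear_combination h_minus, by linear_combination h_plus⟩

lemma KNAngularEqs.deriv_eq (h : KNAngularEqs p μ m ω lam Sm Sp θ) :
    deriv Sm θ = -(ω * p.a * Real.sin θ - m / Real.sin θ + Real.cos θ / (2 * Real.sin θ)) * Sm θ
      + (lam + μ * p.a * Real.cos θ) * Sp θ ∧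
    deriv Sp θ = (-lam + μ * p.a * Real.cos θ) * Sm θ
      + (ω * p.a * Real.sin θ - m / Real.sin θ - Real.cos θ / (2 * Real.sin θ)) * Sp θ :=
  ⟨by linear_combination h.2, by linear_combination h.1⟩

lemma hasDerivAt_DKN (p : Params) (r : ℝ) : HasDerivAt (DKN p) (2 * (r - p.M)) r := by
  have h_id := hasDerivAt_id' r
  have := (((h_id.fun_pow 2).add_const (p.a ^ 2)).add_const (p.e ^ 2)).fun_sub
    (h_id.const_mul (2 * p.M))
  exact this.congr_deriv (by ring)

lemma hasDerivAt_KPage (p : Params) (q m : ℝ) (ω : ℂ) (r : ℝ) :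
    HasDerivAt (KPage p q m ω) (2 * ω * r + p.e * q) r := by
  have h_id := Complex.ofRealCLM.hasDerivAt (x := r)
  have := ((((h_id.fun_pow 2).add_const ((p.a : ℂ) ^ 2)).mul_const ω).sub_const
    ((m : ℂ) * p.a)).fun_add (h_id.const_mul ((p.e : ℂ) * q))
  exact this.congr_deriv (by
    simp only [Complex.ofRealCLM_apply]
    push_cast
    ring)

lemma hasDerivAt_div_sqrt_DKN (hΔ : 0 < DKN p r) (hlam : lam + Complex.I * μ * r ≠ 0) :
    HasDerivAt (fun s : ℝ => (lam + Complex.I * μ * s) / (√(DKN p s) : ℝ))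
      ((Complex.I * μ / (lam + Complex.I * μ * r) - (r - p.M) / DKN p r) *
        ((lam + Complex.I * μ * r) / (√(DKN p r) : ℝ))) r := by
  have h_sqrt : ((√(DKN p r) : ℝ) : ℂ) ≠ 0 := ofReal_sqrt_ne_zero hΔ
  have h_sq : (DKN p r : ℂ) = ((√(DKN p r) : ℝ) : ℂ) ^ 2 := ofReal_eq_sqrt_sq hΔ.le
  have h_num := ((Complex.ofRealCLM.hasDerivAt (x := r)).const_mul (Complex.I * μ)).const_add lam
  refine (h_num.fun_div ((hasDerivAt_DKN p r).sqrt hΔ.ne').ofReal_comp h_sqrt).congr_deriv ?_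
  simp only [Complex.ofRealCLM_apply, h_sq]
  push_cast
  field_simp

lemma pageRadial_of_KNRadialEqs (hRm : DifferentiableAt ℝ Rm r) (hRp : DifferentiableAt ℝ Rp r)
    (h : ∀ᶠ s in nhds r, 0 < DKN p s ∧ KNRadialEqs p q μ m ω lam Rm Rp s)
    (hlam : lam + Complex.I * μ * r ≠ 0) :
    DifferentiableAt ℝ (deriv Rm) r ∧ PageRadial p q μ m ω lam Rm r := by
  obtain ⟨hΔ, h_eqs⟩ := h.self_of_nhds
  have h_sqrt : ((√(DKN p r) : ℝ) : ℂ) ≠ 0 := ofReal_sqrt_ne_zero hΔ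
  have h_sq : (DKN p r : ℂ) = ((√(DKN p r) : ℝ) : ℂ) ^ 2 := ofReal_eq_sqrt_sq hΔ.le
  have h_ne : (DKN p r : ℂ) ≠ 0 := mod_cast hΔ.ne'
  have h_second := hasDerivAt_deriv_of_first_order_system hRm
    (h.mono fun s hs => (hs.2.deriv_eq hs.1).1)
    (hRp.hasDerivAt.congr_deriv (h_eqs.deriv_eq hΔ).2)
    (((hasDerivAt_KPage p q m ω r).const_mul Complex.I).fun_div
      (hasDerivAt_DKN p r).ofReal_comp h_ne)
    (hasDerivAt_div_sqrt_DKN hΔ hlam)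
  refine ⟨h_second.differentiableAt, ?_⟩
  rw [PageRadial, h_second.deriv, h_sq]
  push_cast
  field_simp
  grind [Complex.I_sq]

lemma pageAngular_of_KNAngularEqs (hsin : Real.sin θ ≠ 0) (hSm : DifferentiableAt ℝ Sm θ)
    (hSp : DifferentiableAt ℝ Sp θ) (h : ∀ᶠ s in nhds θ, KNAngularEqs p μ m ω lam Sm Sp s)
    (hlam : lam + μ * p.a * Real.cos θ ≠ 0) :
    DifferentiableAt ℝ (deriv Sm) θ ∧ PageAngular p μ m ω lam Sm θ := by
  have hs : (Real.sin θ : ℂ) ≠ 0 := mod_cast hsin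
  have h_sin := (Real.hasDerivAt_sin θ).ofReal_comp
  have h_cos := (Real.hasDerivAt_cos θ).ofReal_comp
  have h_log : HasDerivAt (fun s : ℝ => lam + μ * p.a * Real.cos s)
      (-(μ * p.a * Real.sin θ) / (lam + μ * p.a * Real.cos θ) * (lam + μ * p.a * Real.cos θ)) θ :=
    ((h_cos.const_mul (μ * p.a : ℂ)).const_add lam).congr_deriv <| by
      rw [div_mul_cancel₀ _ hlam]
      push_cast
      ring
  have h_second := hasDerivAt_deriv_of_first_order_system hSm
    (h.mono fun s hs => hs.deriv_eq.1) (hSp.hasDerivAt.congr_deriv h.self_of_nhds.deriv_eq.2)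
    (((h_sin.const_mul (ω * p.a)).fun_sub ((hasDerivAt_const θ (m : ℂ)).fun_div h_sin hs)).fun_add
      (h_cos.fun_div (h_sin.const_mul 2) (mul_ne_zero two_ne_zero hs))).fun_neg
    h_log
  refine ⟨h_second.differentiableAt, ?_⟩
  rw [PageAngular, h_second.deriv]
  push_cast
  simp only [← Complex.ofReal_sin, ← Complex.ofReal_cos]
  field_simp
  have : (Real.sin θ : ℂ) ^ 2 + (Real.cos θ : ℂ) ^ 2 = 1 := mod_cast Real.sin_sq_add_cos_sq θ
  grind

end SecondOrder

end KNdS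

end

theorem mainTheorem2 (p : KNdS.Params) (hXi : KNdS.Xi p ≠ 0) (q μ m : ℝ) (ω : ℂ) :
    -- the tetrad, its spin coefficients and the Dirac equation in the tetrad
    (∀ x : KNdS.Point, KNdS.Dr p (x 1) ≠ 0 → 0 < x 2 → x 2 < Real.pi → 0 < KNdS.Dθ p (x 2) →
      KNdS.rhoSq p (x 1) (x 2) ≠ 0 →
      -- the tetrad is a null tetrad
      (∀ b c : Fin 4, ∑ i, ∑ j, (KNdS.metric p x i j : ℂ) * KNdS.tetrad p x b i *
        KNdS.tetrad p x c j = KNdS.nullEta b c) ∧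
      -- the spin coefficients
      KNdS.npκ p x = 0 ∧ KNdS.npσ p x = 0 ∧ KNdS.npν p x = 0 ∧ KNdS.npLam p x = 0 ∧
      KNdS.npε p x = 0 ∧
      KNdS.npπ p x = 1 / 2 * (Complex.I * p.a * Real.sin (x 2) * (√(2 * KNdS.Dθ p (x 2)) : ℝ) /
        conj (KNdS.rhoBar p (x 1) (x 2)) ^ 2) ∧
      KNdS.npβ p x = 1 / (2 * Real.sin (x 2) * (√2 : ℝ) * KNdS.rhoBar p (x 1) (x 2)) *
        KNdS.dSqrtSin p (x 2) ∧
      KNdS.npγ p x = 1 / (4 * KNdS.rhoSq p (x 1) (x 2)) * (deriv (KNdS.Dr p) (x 1) : ℝ) -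
        1 / (2 * KNdS.rhoSq p (x 1) (x 2) * conj (KNdS.rhoBar p (x 1) (x 2))) *
          KNdS.Dr p (x 1) ∧
      KNdS.npρ p x = -1 / conj (KNdS.rhoBar p (x 1) (x 2)) ∧
      KNdS.npμ p x = -KNdS.Dr p (x 1) /
        (2 * KNdS.rhoSq p (x 1) (x 2) * conj (KNdS.rhoBar p (x 1) (x 2))) ∧
      KNdS.npτ p x = -Complex.I * (√(2 * KNdS.Dθ p (x 2)) : ℝ) * p.a * Real.sin (x 2) /
        (2 * KNdS.rhoSq p (x 1) (x 2)) ∧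
      KNdS.npα p x = KNdS.npπ p x - conj (KNdS.npβ p x) ∧
      -- the components of the two-spinor Dirac equation (for every charge `q'`)
      (∀ (q' mass : ℝ) (P Q : KNdS.Spinor), KNdS.HalfDirac p q' mass P Q x ↔
        (KNdS.frameDeriv p 1 (P 1) x + (-KNdS.npγ p x + KNdS.npμ p x
              + Complex.I * q' * KNdS.potFrame p 1 x) * P 1 x
            + (KNdS.frameDeriv p 2 (P 0) x + (-KNdS.npτ p x + KNdS.npβ p x
              + Complex.I * q' * KNdS.potFrame p 2 x) * P 0 x)
          = -Complex.I * mass * conj (Q 0 x)) ∧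
        (-KNdS.frameDeriv p 0 (P 0) x + (KNdS.npρ p x - KNdS.npε p x
              - Complex.I * q' * KNdS.potFrame p 0 x) * P 0 x
            + (-KNdS.frameDeriv p 3 (P 1) x + (KNdS.npα p x - KNdS.npπ p x
              - Complex.I * q' * KNdS.potFrame p 3 x) * P 1 x)
          = -Complex.I * mass * conj (Q 1 x))) ∧
      -- the directional derivatives on fields `e^{i(mφ - ωt)} f(r, θ)`
      (∀ f : ℝ → ℝ → ℂ,
        KNdS.frameDeriv p 0 (fun y => KNdS.modePhase m ω y * f (y 1) (y 2)) x =
          KNdS.modePhase m ω x * (deriv (fun r => f r (x 2)) (x 1) +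
            Complex.I * KNdS.Xi p / KNdS.Dr p (x 1) * KNdS.K p m ω (x 1) * f (x 1) (x 2)) ∧
        KNdS.frameDeriv p 1 (fun y => KNdS.modePhase m ω y * f (y 1) (y 2)) x =
          KNdS.modePhase m ω x * (-KNdS.Dr p (x 1) / (2 * KNdS.rhoSq p (x 1) (x 2)) *
            (deriv (fun r => f r (x 2)) (x 1) -
              Complex.I * KNdS.Xi p * KNdS.K p m ω (x 1) / KNdS.Dr p (x 1) * f (x 1) (x 2))) ∧
        KNdS.frameDeriv p 2 (fun y => KNdS.modePhase m ω y * f (y 1) (y 2)) x =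
          KNdS.modePhase m ω x *
            ((√(KNdS.Dθ p (x 2)) : ℝ) / ((√2 : ℝ) * KNdS.rhoBar p (x 1) (x 2)) *
            (deriv (f (x 1)) (x 2) +
              KNdS.Xi p * KNdS.H p m ω (x 2) / KNdS.Dθ p (x 2) * f (x 1) (x 2))) ∧
        KNdS.frameDeriv p 3 (fun y => KNdS.modePhase m ω y * f (y 1) (y 2)) x =
          KNdS.modePhase m ω x *
            ((√(KNdS.Dθ p (x 2)) : ℝ) / ((√2 : ℝ) * conj (KNdS.rhoBar p (x 1) (x 2))) *
            (deriv (f (x 1)) (x 2) -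
              KNdS.Xi p * KNdS.H p m ω (x 2) / KNdS.Dθ p (x 2) * f (x 1) (x 2))))) ∧
    -- the separation, on a region `r ∈ I`, `θ ∈ J`
    (∀ (I J : Set ℝ), IsOpen I → IsOpen J → J ⊆ Set.Ioo 0 Real.pi →
      (∀ r ∈ I, 0 < KNdS.Dr p r) → (∀ θ ∈ J, 0 < KNdS.Dθ p θ) →
      (∀ r ∈ I, ∀ θ ∈ J, KNdS.rhoSq p r θ ≠ 0) →
      ∀ Rm Rp Sm Sp : ℝ → ℂ,
      (∀ r ∈ I, DifferentiableAt ℝ Rm r ∧ DifferentiableAt ℝ Rp r) →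
      (∀ θ ∈ J, DifferentiableAt ℝ Sm θ ∧ DifferentiableAt ℝ Sp θ) →
      -- solutions of the separated equations give solutions of the Dirac equation
      (∀ lam : ℂ, (∀ r ∈ I, KNdS.RadialEqs p q μ m ω lam Rm Rp r) →
        (∀ θ ∈ J, KNdS.AngularEqs p μ m ω lam Sm Sp θ) →
        ∀ x : KNdS.Point, x 1 ∈ I → x 2 ∈ J →
          KNdS.Dirac p q (μ / √2) (KNdS.ansatzP p m ω Rm Rp Sm Sp)
            (KNdS.conjSpinor (KNdS.ansatzQbar p m ω Rm Rp Sm Sp)) x) ∧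
      -- a nontrivial product solution of the Dirac equation separates
      ((∃ r ∈ I, Rm r ≠ 0 ∨ Rp r ≠ 0) → (∃ θ ∈ J, Sm θ ≠ 0 ∨ Sp θ ≠ 0) →
        (∀ x : KNdS.Point, x 1 ∈ I → x 2 ∈ J →
          KNdS.Dirac p q (μ / √2) (KNdS.ansatzP p m ω Rm Rp Sm Sp)
            (KNdS.conjSpinor (KNdS.ansatzQbar p m ω Rm Rp Sm Sp)) x) →
        ∃ lam : ℂ, (∀ r ∈ I, KNdS.RadialEqs p q μ m ω lam Rm Rp r) ∧
          (∀ θ ∈ J, KNdS.AngularEqs p μ m ω lam Sm Sp θ)) ∧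
      -- for `Λ = 0` the separated equations are the Kerr–Newman ones
      (p.Λ = 0 → ∀ lam : ℂ,
        (∀ r ∈ I, KNdS.RadialEqs p q μ m ω lam Rm Rp r ↔
          KNdS.KNRadialEqs p q μ m ω lam Rm Rp r) ∧
        (∀ θ ∈ J, KNdS.AngularEqs p μ m ω lam Sm Sp θ ↔
          KNdS.KNAngularEqs p μ m ω lam Sm Sp θ) ∧
        ((∀ r ∈ I, KNdS.RadialEqs p q μ m ω lam Rm Rp r) →
          ∀ r ∈ I, lam + Complex.I * μ * r ≠ 0 →
            DifferentiableAt ℝ (deriv Rm) r ∧ KNdS.PageRadial p q μ m ω lam Rm r) ∧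
        ((∀ θ ∈ J, KNdS.AngularEqs p μ m ω lam Sm Sp θ) →
          ∀ θ ∈ J, lam + μ * p.a * Real.cos θ ≠ 0 →
            DifferentiableAt ℝ (deriv Sm) θ ∧ KNdS.PageAngular p μ m ω lam Sm θ))) := by
  refine ⟨fun x hDr h0 hπ hDθ hρ => ?_, fun I J hI hJ hJπ hDr hDθ hρ Rm Rp Sm Sp hR hS => ?_⟩
  · have h : KNdS.Regular p x := ⟨hXi, hDr, (Real.sin_pos_of_pos_of_lt_pi h0 hπ).ne', hDθ, hρ⟩
    exact ⟨KNdS.sum_metric_mul_tetrad h, KNdS.npκ_eq_zero h, KNdS.npσ_eq_zero h, KNdS.npν_eq_zero h,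
      KNdS.npLam_eq_zero h, KNdS.npε_eq_zero h, KNdS.npπ_eq h, KNdS.npβ_eq h, KNdS.npγ_eq h,
      KNdS.npρ_eq h, KNdS.npμ_eq h, KNdS.npτ_eq h, KNdS.npα_eq h, KNdS.halfDirac_iff p x,
      fun f => ⟨KNdS.frameDeriv_zero_mode m ω f, KNdS.frameDeriv_one_mode h m ω f,
        KNdS.frameDeriv_two_mode h m ω f, KNdS.frameDeriv_three_mode h m ω f⟩⟩
  · have hsin : ∀ θ ∈ J, Real.sin θ ≠ 0 := fun θ hθ => (Real.sin_pos_of_mem_Ioo (hJπ hθ)).ne'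
    have h : ∀ x : KNdS.Point, x 1 ∈ I → x 2 ∈ J → KNdS.Regular p x := fun x hr hθ =>
      ⟨hXi, (hDr _ hr).ne', hsin _ hθ, hDθ _ hθ, hρ _ hr _ hθ⟩
    refine ⟨fun lam h_radial h_angular x hr hθ => KNdS.dirac_ansatz_of_separated (h x hr hθ)
        (hDr _ hr) (hR _ hr).1 (hR _ hr).2 (hS _ hθ).1 (hS _ hθ).2 (h_radial _ hr) (h_angular _ hθ),
      KNdS.exists_separation_constant h hDr hDθ hR hS, fun hΛ lam => ⟨fun r _ =>
        KNdS.radialEqs_iff_KNRadialEqs hΛ, fun θ _ => KNdS.angularEqs_iff_KNAngularEqs hΛ,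
        fun h_radial r hr => KNdS.pageRadial_of_KNRadialEqs (hR r hr).1 (hR r hr).2 ?_,
        fun h_angular θ hθ => KNdS.pageAngular_of_KNAngularEqs (hsin θ hθ) (hS θ hθ).1
          (hS θ hθ).2 ?_⟩⟩
    · filter_upwards [hI.mem_nhds hr] with s hs
      exact ⟨KNdS.Dr_of_Λ_eq_zero hΛ ▸ hDr s hs,
        (KNdS.radialEqs_iff_KNRadialEqs hΛ).1 (h_radial s hs)⟩
    · filter_upwards [hJ.mem_nhds hθ] with s hs
      exact (KNdS.angularEqs_iff_KNAngularEqs hΛ).1 (h_angular s hs)
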